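/- **Setting.** Let $m\ge 1$ and $d$ be integers, $d\ge 0$. Let $\Omega\subset\mathbb R^d$ be compact and satisfy an interior cone condition with radius $r>0$ and angle $\theta\in(0,\pi/2)$: for every $a\in\Omega$ there is a unit vector $\xi$ with $\{a+ty:\ \|y\|=1,\ y\cdot\xi\ge\cos\theta,\ 0\le t\le r\}\subset\Omega$. Put $C(\theta)=\dfrac{16(1+\sin\theta)^2m^2}{3\sin^2\theta}$. Let $\Omega^*\supseteq\Omega$ be a compact set on which derivatives are uniquely determined (in the sense that at each of its points the tangent directions span a dense subspace and the point is not isolated), such that for some $\kappa,\rho>0$ any two points $a,b\in\Omega$ with $\|a-b\|\le\rho$ can be joined by a curve in $\Omega^*$ of length at most $\kappa\|a-b\|$. (The choice $\Omega^*=\Omega$ is allowed whenever $\Omega$ itself has this property, e.g. if $\Omega$ is convex or a Lipschitz domain; a closed ball containing $\Omega$ is always allowed.) Here $C^{m+1}(\Omega^*)$ is the space of functions that are $m+1$ times continuously differentiable on $\Omega^*$, with $\|\phi\|_{C^{m+1}(\Omega^*)}=\max_{0\le k\le m+1}\sup_{z\in\Omega^*}\|D^k\phi(z)\|$ (derivatives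 on $\Omega^*$, operator norms). For points $X=\{x_1,\dots,x_N\}\subset\Omega$ let $h=h_{X,\Omega}=\sup_{z\in\Omega}\min_j\|z-x_j\|$ be the fill distance and $q_X=\frac12\min_{i\ne j}\|x_i-x_j\|$ the separation distance. Assume that $X$ is quasi-uniform with constant $c$, i.e. $q_X\le h\le c\,q_X$, and that $h\le r/C(\theta)$. Put $\delta=2C(\theta)h$. Let $\Phi:[0,\infty)\to[0,\infty)$ be a continuous weight with $\Phi(s)=0$ for $s>\delta$ and $\Phi(s)>0$ for $0\le s<\delta/2$, of a fixed profile: $\Phi(s)=\psi(s/\delta)$ with $\psi$ independent of $X$. For $x_i\in X$ and $\varepsilon\ge\delta$ let $N_i^\varepsilon=\{x_j\in X:\|x_j-x_i\|<\varepsilon\}$, and let $x_{ij}=\frac12(x_i+x_j)$, $x_j\in N_i^\varepsilon$, be the midpoints of the edges from $x_i$. The topological gradient of a nodal function $\phi^h$ is $GRAD_i(\phi^h)_{ij}=\phi^h_j-\phi^h_i$. Let $P^i_m$ be the space of polynomials $p$ of degree at most $m$ with $p(x_i)=0$. For edge values $u=(u_{ij})_j$ let $$p^*=\operatorname*{arg\,min}_{p\in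 P^i_m}\ \sum_{x_j\in N_i^\varepsilon}\bigl[u_{ij}-p(x_{ij})\bigr]^2\,\Phi(\|x_i-x_{ij}\|),\qquad DIV_i(u)=\tfrac14\,\widetilde\Delta p^*(x_i),$$ where, if $p^*=\sum_k b_kp_k$ in a basis $\{p_k\}$ of $P^i_m$, $\widetilde\Delta p^*(x_i)=\sum_kb_k\Delta p_k(x_i)$ and $\widetilde\nabla p^*(x_i)=\sum_kb_k\nabla p_k(x_i)$. **Theorem 5.1.** There is a constant $C>0$, depending only on $d,m,\Omega,r,\theta,\Omega^*,c$ and $\psi$ (not on $X$, $h$, $x_i$, $\varepsilon$ or $\phi$), such that for all $X$, $\Phi$, $x_i\in X$ and $\varepsilon$ as above and all $\phi\in C^{m+1}(\Omega^*)$, with interpolant $\phi^h_j=\phi(x_j)$: the least-squares problem with data $u=GRAD_i(\phi^h)$ has exactly one solution $p^*$, and $$\bigl|\Delta\phi(x_i)-DIV_i\circ GRAD_i(\phi^h)\bigr|\le C\,h^{m-1}\,\|\phi\|_{C^{m+1}(\Omega^*)},$$ $$\bigl\|\nabla\phi(x_i)-\tfrac12\widetilde\nabla p^*(x_i)\bigr\|\le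 C\,h^{m}\,\|\phi\|_{C^{m+1}(\Omega^*)}.$$ -/

import Mathlib

noncomputable section

namespace StaggeredGMLS

/-- Euclidean space `ℝ^d` with the Euclidean norm. -/
abbrev Pt (d : ℕ) : Type := EuclideanSpace ℝ (Fin d)

/-! ## The domain -/

/-- The closed cone of apex `a`, axis `ξ` (a unit vector), half-angle `θ` and radius `r`:
the points `a + t y` with `‖y‖ = 1`, `⟪y, ξ⟫ ≥ cos θ` and `0 ≤ t ≤ r`. -/
def cone {d : ℕ} (a ξ : Pt d) (θ r : ℝ) : Set (Pt d) :=
  {z | ∃ (y : Pt d) (t : ℝ), ‖y‖ = 1 ∧ Real.cos θ ≤ inner ℝ y ξ ∧ 0 ≤ t ∧ t ≤ r ∧ z = a + t • y}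

/-- Interior cone condition with radius `r` and angle `θ`: every point of `Ω` is the apex of a
cone of that radius and angle which is contained in `Ω`. -/
def InteriorConeCondition {d : ℕ} (Ω : Set (Pt d)) (r θ : ℝ) : Prop :=
  ∀ a ∈ Ω, ∃ ξ : Pt d, ‖ξ‖ = 1 ∧ cone a ξ θ r ⊆ Ω

/-- The condition on the domain: compact, with an interior cone condition of radius `r > 0` and
angle `θ ∈ (0, π/2)`. -/
structure DomainCondition {d : ℕ} (Ω : Set (Pt d)) (r θ : ℝ) : Prop where
  compact : IsCompact Ω
  radius_pos : 0 < r
  angle_pos : 0 < θ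
  angle_lt : θ < Real.pi / 2
  cone_condition : InteriorConeCondition Ω r θ

/-- Any two points of `Ω` at distance at most `ρ` can be joined by a curve in `S` of length at most
`κ` times their distance. (The curve is parametrized on `[0,1]`, with Lipschitz constant
`κ ‖a - b‖`; `S` convex and `κ = 1` is the simplest example.) -/
def JoinedByShortCurves {d : ℕ} (Ω S : Set (Pt d)) (κ ρ : ℝ) : Prop :=
  ∀ a ∈ Ω, ∀ b ∈ Ω, dist a b ≤ ρ →
    ∃ γ : ℝ → Pt d, γ 0 = a ∧ γ 1 = b ∧
      (∀ t ∈ Set.Icc (0 : ℝ) 1, γ t ∈ S) ∧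
      (∀ s ∈ Set.Icc (0 : ℝ) 1, ∀ t ∈ Set.Icc (0 : ℝ) 1,
        dist (γ s) (γ t) ≤ κ * dist a b * |s - t|)

/-- `S` is a set on which smoothness of functions given on `Ω` may be measured: a compact set
containing `Ω`, on which derivatives are unique, and in which nearby points of `Ω` can be joined by
curves of comparable length. `S = Ω` is allowed if `Ω` is, e.g., convex or a Lipschitz domain; a
compact convex set, or a closed tubular neighbourhood of `Ω`, is always allowed. -/
structure RegularityRegion {d : ℕ} (Ω S : Set (Pt d)) : Prop where
  subset : Ω ⊆ S
  compact : IsCompact S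
  uniqueDiff : UniqueDiffOn ℝ S
  joined : ∃ κ ρ : ℝ, 0 < ρ ∧ JoinedByShortCurves Ω S κ ρ

/-- The norm of `C^n(S)`, `S` compact: the largest value on `S` of a derivative of order `≤ n`. -/
def ckNorm {d : ℕ} (n : ℕ) (S : Set (Pt d)) (φ : Pt d → ℝ) : ℝ :=
  sSup {c : ℝ | ∃ k ≤ n, ∃ z ∈ S, c = ‖iteratedFDerivWithin ℝ k φ S z‖}

/-! ## The nodes -/

/-- The constant `C(θ) = 16 (1 + sin θ)² m² / (3 sin² θ)`. -/
def coneConst (m : ℕ) (θ : ℝ) : ℝ :=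
  16 * (1 + Real.sin θ) ^ 2 * (m : ℝ) ^ 2 / (3 * Real.sin θ ^ 2)

/-- Fill distance `h_{X,Ω} = sup_{z ∈ Ω} min_j ‖z - x_j‖`. -/
def fillDistance {d N : ℕ} (x : Fin N → Pt d) (Ω : Set (Pt d)) : ℝ :=
  sSup ((fun z => Metric.infDist z (Set.range x)) '' Ω)

/-- Separation distance `q_X = ½ min_{i ≠ j} ‖x_i - x_j‖`. -/
def separationDistance {d N : ℕ} (x : Fin N → Pt d) : ℝ :=
  sInf {c : ℝ | ∃ i j : Fin N, i ≠ j ∧ c = dist (x i) (x j)} / 2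

/-- The condition on the nodes: they lie in `Ω`, are quasi-uniform with constant `c`, that is
`q_X ≤ h_{X,Ω} ≤ c q_X`, and have fill distance at most `h₀ = r / C(θ)`. -/
structure NodeCondition {d N : ℕ} (Ω : Set (Pt d)) (r θ : ℝ) (m : ℕ) (c : ℝ)
    (x : Fin N → Pt d) : Prop where
  mem : ∀ j, x j ∈ Ω
  sep_le_fill : separationDistance x ≤ fillDistance x Ω
  fill_le_sep : fillDistance x Ω ≤ c * separationDistance x
  fill_le : fillDistance x Ω ≤ r / coneConst m θ

/-! ## The weight -/

/-- The condition on the (radial, continuous, nonnegative) weight `z ↦ Φ ‖z‖`: supported in the ball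
of radius `δ` about the origin and positive in the ball of radius `δ / 2`. -/
structure WeightCondition (Φ : ℝ → ℝ) (δ : ℝ) : Prop where
  cont : ContinuousOn Φ (Set.Ici 0)
  nonneg : ∀ s, 0 ≤ s → 0 ≤ Φ s
  support : ∀ s, δ < s → Φ s = 0
  pos : ∀ s, 0 ≤ s → s < δ / 2 → 0 < Φ s

/-! ## Local primal grid, vertex and edge spaces, topological gradient -/

/-- Indices of the nodes in the `ε`-neighbourhood of `x i`; they also label the local edges
`e_ij = x_j - x_i` and the virtual faces dual to them. -/
abbrev Nbr {d N : ℕ} (x : Fin N → Pt d) (ε : ℝ) (i : Fin N) : Type :=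
  {j : Fin N // ‖x j - x i‖ < ε}

instance {d N : ℕ} (x : Fin N → Pt d) (ε : ℝ) (i : Fin N) : Fintype (Nbr x ε i) :=
  Fintype.ofFinite _

/-- Local vertex space `V^i`. -/
abbrev VertexSpace {d N : ℕ} (x : Fin N → Pt d) (ε : ℝ) (i : Fin N) : Type := Nbr x ε i → ℝ

/-- Local edge space `E^i`, identified with the face space `F^i` through `e_ij ↔ f_ij`. -/
abbrev EdgeSpace {d N : ℕ} (x : Fin N → Pt d) (ε : ℝ) (i : Fin N) : Type := Nbr x ε i → ℝ

/-- Restriction to `V^i` of a global nodal function. -/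
def restrictNodal {d N : ℕ} (x : Fin N → Pt d) (ε : ℝ) (i : Fin N) (u : Fin N → ℝ) :
    VertexSpace x ε i :=
  fun j => u j

/-- The topological gradient `GRAD_i : V^i → E^i`, `u_ij = u_j - u_i`. -/
def topGrad {d N : ℕ} (x : Fin N → Pt d) {ε : ℝ} (hε : 0 < ε) (i : Fin N)
    (u : VertexSpace x ε i) : EdgeSpace x ε i :=
  fun j => u j - u ⟨i, by simpa using hε⟩

/-- The midpoint `x_ij = (x_i + x_j) / 2`. -/
def edgeMid {d N : ℕ} (x : Fin N → Pt d) (i j : Fin N) : Pt d := (1 / 2 : ℝ) • (x i + x j)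

/-! ## Polynomials -/

/-- The value of a polynomial at a point. -/
def polyEval {d : ℕ} (z : Pt d) (p : MvPolynomial (Fin d) ℝ) : ℝ :=
  MvPolynomial.eval (fun k => z k) p

/-- The space `P_m^i` of polynomials of degree at most `m` that vanish at `a = x_i`. -/
def vanishingPoly {d : ℕ} (m : ℕ) (a : Pt d) : Set (MvPolynomial (Fin d) ℝ) :=
  {p | p.totalDegree ≤ m ∧ polyEval a p = 0}

/-- The gradient of a polynomial at a point. -/
def polyGrad {d : ℕ} (z : Pt d) (p : MvPolynomial (Fin d) ℝ) : Pt d :=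
  WithLp.toLp 2 (fun k => polyEval z (MvPolynomial.pderiv k p))

/-- The Laplacian of a polynomial at a point. -/
def polyLaplacian {d : ℕ} (z : Pt d) (p : MvPolynomial (Fin d) ℝ) : ℝ :=
  ∑ k : Fin d, polyEval z (MvPolynomial.pderiv k (MvPolynomial.pderiv k p))

/-! ## GMLS fit from edge data, discrete divergence and flux -/

/-- The weighted least-squares functional
`∑_j (u_ij - p(x_ij))² Φ(‖x_i - x_ij‖)`, the sum being over the local edges. -/
def lsqFunctional {d N : ℕ} (Φ : ℝ → ℝ) (x : Fin N → Pt d) (ε : ℝ) (i : Fin N)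
    (u : EdgeSpace x ε i) (p : MvPolynomial (Fin d) ℝ) : ℝ :=
  ∑ j : Nbr x ε i, (u j - polyEval (edgeMid x i j) p) ^ 2 * Φ ‖x i - edgeMid x i j‖

/-- `p` minimizes the weighted least-squares functional over `P_m^i`. -/
def IsFit {d N : ℕ} (m : ℕ) (Φ : ℝ → ℝ) (x : Fin N → Pt d) (ε : ℝ) (i : Fin N)
    (u : EdgeSpace x ε i) (p : MvPolynomial (Fin d) ℝ) : Prop :=
  p ∈ vanishingPoly m (x i) ∧ IsMinOn (lsqFunctional Φ x ε i u) (vanishingPoly m (x i)) p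

open Classical in
/-- The polynomial `p*` fitted at `x_i` to the edge data `u`. -/
def gmlsFit {d N : ℕ} (m : ℕ) (Φ : ℝ → ℝ) (x : Fin N → Pt d) (ε : ℝ) (i : Fin N)
    (u : EdgeSpace x ε i) : MvPolynomial (Fin d) ℝ :=
  if h : ∃ p, IsFit m Φ x ε i u p then h.choose else 0

/-- The discrete divergence `DIV_i u = ¼ Δ̃p*(x_i)`. The GMLS Laplacian of `p* = ∑ b_k p_k` is
`∑ b_k Δp_k(x_i)`, the coefficients `b_k` being those fitted at `x_i`; by linearity this is the
Laplacian at `x_i` of the one polynomial `gmlsFit`. -/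
def gmlsDiv {d N : ℕ} (m : ℕ) (Φ : ℝ → ℝ) (x : Fin N → Pt d) (ε : ℝ) (i : Fin N)
    (u : EdgeSpace x ε i) : ℝ :=
  (1 / 4) * polyLaplacian (x i) (gmlsFit m Φ x ε i u)

/-- The reconstructed vector field `½ ∇̃p*(x_i)`, where `∇̃p*(x_i) = ∑ b_k ∇p_k(x_i)`. -/
def gmlsField {d N : ℕ} (m : ℕ) (Φ : ℝ → ℝ) (x : Fin N → Pt d) (ε : ℝ) (i : Fin N)
    (u : EdgeSpace x ε i) : Pt d :=
  (1 / 2 : ℝ) • polyGrad (x i) (gmlsFit m Φ x ε i u)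

end StaggeredGMLS

end

noncomputable section

namespace StaggeredGMLS

/-! Write `a = x_i` and let `T` be the Taylor polynomial of `φ` at `a` of degree `m`. The polynomial
`q(y) = T(2y - a) - φ(a)` has degree at most `m`, vanishes at `a`, and takes at the midpoint `x_ij`
the value `T(x_j) - φ(x_i)`. So it reproduces the edge datum `φ(x_j) - φ(x_i)` up to the Taylor
remainder, which is `O(h^(m+1))` on the edges that carry weight. By the chain rule the gradient and
Laplacian of `T` at `a` are `½∇q(a)` and `¼Δq(a)`; this is where the factors in the discrete
operators come from. It remains to compare `q` with the fit `p*`.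

Consistency: minimality of `p*` bounds the weighted sum of squares of `q - p*` at the midpoints by
four times the residual of `q`. Quasi-uniformity bounds the number of edges with nonzero weight,
whatever `ε` is, so this sum is `O(h^(2m+2))` (`exists_lsqFunctional_midTaylor_le`).

Stability: the midpoints in a half-size cone at `a`, of diameter comparable to `h`, form a norming
set for polynomials of degree at most `m` (`NodeCondition.exists_norming_cone`). At a maximum point
of `|p|` on the cone, Markov's inequality shows that a short move towards the inscribed ball costs
at most half the maximum, and a midpoint can be reached by such a move. Hence `q - p*` is
`O(h^(m+1))` on the cone, and by Markov each derivative at the apex costs a factor `1/h`. The same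
norming property makes the fit unique.

The Taylor remainder is estimated along short curves in `S`, with derivatives taken within `S`. This
needs symmetric higher derivatives at boundary points, which pass to the limit from the interior,
since the cone condition puts `Ω` in the closure of its interior. -/

/-! ### Markov's inequality at the end of an interval -/

open Polynomial in
theorem abs_derivative_eval_zero_le {Q : ℝ[X]} {m : ℕ} (hQ : Q.natDegree ≤ m) {M : ℝ}
    (hM : ∀ t ∈ Set.Icc (0 : ℝ) 1, |Q.eval t| ≤ M) :
    |Q.derivative.eval 0| ≤ 2 * (m : ℝ) ^ 2 * M := by
  have hM0 : 0 ≤ M := (abs_nonneg _).trans (hM 0 (by simp))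
  rcases hM0.eq_or_lt with rfl | hpos
  · have : Q = 0 := Polynomial.eq_zero_of_infinite_isRoot Q <|
      (Set.Icc_infinite (zero_lt_one (α := ℝ))).mono fun t ht => by
        simpa using le_antisymm (hM t ht) (abs_nonneg _)
    simp [this]
  -- The substitution `t = (1 - x)/2` sends `x = 1` to `t = 0` and produces the factor 2. Among
  -- polynomials of degree at most `m` bounded by 1 on `[-1, 1]`, the Chebyshev polynomial has the
  -- largest derivative at 1, namely `m²`. The sign `c` turns this one-sided bound into one for the
  -- absolute value.
  have key : ∀ c : ℝ, |c| = 1 → -(c * Q.derivative.eval 0) ≤ 2 * (m : ℝ) ^ 2 * M := by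
    intro c hc
    set P : ℝ[X] := C (c / M) * Q.comp (C (1 / 2) - C (1 / 2) * X) with hP
    have hdeg : P.degree ≤ (m : ℕ) := by
      refine natDegree_le_iff_degree_le.1 ?_
      refine (natDegree_C_mul_le _ _).trans (natDegree_comp_le.trans ?_)
      have h1 : (C (1 / 2 : ℝ) - C (1 / 2) * X).natDegree ≤ 1 := by compute_degree
      exact (Nat.mul_le_mul hQ h1).trans (by simp)
    have hb : ∀ x ∈ Set.Icc (-1 : ℝ) 1, |P.eval x| ≤ 1 := by
      intro x hx
      have := hM (1 / 2 - 1 / 2 * x) ⟨by linarith [hx.2], by linarith [hx.1]⟩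
      simp only [hP, eval_mul, eval_C, eval_comp, eval_sub, eval_X, abs_mul, abs_div, hc,
        abs_of_pos hpos]
      rw [one_div_mul_eq_div, div_le_one hpos]
      exact this
    have h := Chebyshev.eval_iterate_derivative_le_of_forall_abs_le_one (k := 1) le_rfl hdeg hb
    simp only [Function.iterate_one, Chebyshev.T_derivative_eq_U, hP, derivative_mul, derivative_C,
      derivative_comp, derivative_sub, derivative_X, eval_mul, eval_add, eval_comp, eval_sub,
      eval_C, eval_X] at h
    simp only [eval_zero, Chebyshev.U_eval_one] at h
    norm_num at h
    rw [div_mul_eq_mul_div, ← neg_div, div_le_iff₀ hpos] at h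
    nlinarith
  rw [abs_le]
  constructor
  · linarith [key 1 (by simp)]
  · linarith [key (-1) (by simp)]

-- The endpoint inequality, rescaled to `[t, 1]`, bounds the derivative at each `t ≤ l` by `2m²M/(1
-- - l)`; then the mean value inequality applies on `[0, l]`.
open Polynomial in
theorem abs_eval_sub_eval_zero_le {Q : ℝ[X]} {m : ℕ} (hQ : Q.natDegree ≤ m) {M l : ℝ}
    (hM : ∀ t ∈ Set.Icc (0 : ℝ) 1, |Q.eval t| ≤ M) (hl0 : 0 ≤ l) (hl1 : l < 1) :
    |Q.eval l - Q.eval 0| ≤ 2 * (m : ℝ) ^ 2 * M / (1 - l) * l := by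
  have hM0 : 0 ≤ M := (abs_nonneg _).trans (hM 0 (by simp))
  have hder : ∀ t ∈ Set.Icc (0 : ℝ) l, ‖Q.derivative.eval t‖ ≤ 2 * (m : ℝ) ^ 2 * M / (1 - l) := by
    intro t ht
    have hdeg : (Q.comp (C t + C (1 - t) * X)).natDegree ≤ m := by
      refine natDegree_comp_le.trans ?_
      have h1 : (C t + C (1 - t) * X).natDegree ≤ 1 := by compute_degree
      exact (Nat.mul_le_mul hQ h1).trans (by simp)
    have := abs_derivative_eval_zero_le hdeg (M := M) (fun u hu => by
      rw [eval_comp]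
      refine hM _ ?_
      simp only [eval_add, eval_mul, eval_C, eval_X]
      have h1 : 0 ≤ 1 - t := by linarith [ht.2]
      constructor
      · nlinarith [ht.1, hu.1]
      · nlinarith [hu.2])
    simp only [derivative_comp, derivative_add, derivative_C, derivative_mul, derivative_X,
      eval_mul, eval_comp, eval_add, eval_C, eval_X, zero_mul,
      zero_add, mul_zero, add_zero, mul_one, abs_mul] at this
    rw [Real.norm_eq_abs, le_div_iff₀ (by linarith)]
    rw [abs_of_nonneg (by linarith [ht.2] : 0 ≤ 1 - t)] at this
    nlinarith [abs_nonneg (Q.derivative.eval t), ht.2]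
  have := (convex_Icc (0 : ℝ) l).norm_image_sub_le_of_norm_hasDerivWithin_le
    (f := fun t => Q.eval t) (f' := fun t => Q.derivative.eval t)
    (fun t _ => (Q.hasDerivAt t).hasDerivWithinAt) hder
    (Set.left_mem_Icc.2 hl0) (Set.right_mem_Icc.2 hl0)
  simpa [abs_of_nonneg hl0] using this

/-! ### Markov's inequality and norming sets on convex bodies -/

theorem totalDegree_pderiv_le {σ R : Type*} [CommSemiring R] (k : σ) (p : MvPolynomial σ R) :
    (MvPolynomial.pderiv k p).totalDegree ≤ p.totalDegree := by
  classical
  conv_lhs => rw [p.as_sum, map_sum]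
  refine MvPolynomial.totalDegree_finsetSum_le fun s hs => ?_
  rw [MvPolynomial.pderiv_monomial]
  refine (MvPolynomial.totalDegree_monomial_le _ _).trans ?_
  refine le_trans ?_ (MvPolynomial.le_totalDegree hs)
  exact Finsupp.degree_mono tsub_le_self

/-- The restriction `t ↦ p (z + t v)` of a polynomial to a line. -/
def lineRestrict {d : ℕ} (z v : Pt d) (p : MvPolynomial (Fin d) ℝ) : Polynomial ℝ :=
  MvPolynomial.aeval (fun k => Polynomial.C (z k) + Polynomial.C (v k) * Polynomial.X) p

theorem natDegree_lineRestrict_le {d m : ℕ} (z v : Pt d) {p : MvPolynomial (Fin d) ℝ}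
    (hp : p.totalDegree ≤ m) : (lineRestrict z v p).natDegree ≤ m := by
  simpa [lineRestrict] using MvPolynomial.aeval_natDegree_le p hp
    (fun k => Polynomial.C (z k) + Polynomial.C (v k) * Polynomial.X) (n := 1)
    (fun i => by compute_degree)

theorem eval_lineRestrict {d : ℕ} (z v : Pt d) (p : MvPolynomial (Fin d) ℝ) (t : ℝ) :
    (lineRestrict z v p).eval t = polyEval (z + t • v) p := by
  induction p using MvPolynomial.induction_on with
  | C a => simp [lineRestrict, polyEval]
  | add p q hp hq => simp_all [lineRestrict, polyEval]
  | mul_X p k hp =>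
    simp only [lineRestrict, polyEval, map_mul, Polynomial.eval_mul] at hp ⊢
    rw [hp]
    simp [mul_comm t]

theorem derivative_lineRestrict_eval_zero {d : ℕ} (z v : Pt d) (p : MvPolynomial (Fin d) ℝ) :
    (lineRestrict z v p).derivative.eval 0
      = ∑ k, v k * polyEval z (MvPolynomial.pderiv k p) := by
  induction p using MvPolynomial.induction_on with
  | C a => simp [lineRestrict, polyEval]
  | add p q hp hq =>
    simp only [lineRestrict, polyEval, map_add, Polynomial.eval_add, mul_add,
      Finset.sum_add_distrib] at hp hq ⊢
    rw [hp, hq]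
  | mul_X p k hp =>
    have h0 := eval_lineRestrict z v p 0
    simp only [zero_smul, add_zero] at h0
    simp only [lineRestrict, polyEval, map_mul, Polynomial.derivative_mul, Polynomial.eval_add,
      Polynomial.eval_mul, Derivation.leibniz, MvPolynomial.pderiv_X] at h0 hp ⊢
    rw [hp, h0]
    simp [Pi.single_apply, mul_add, Finset.sum_add_distrib, Finset.sum_mul, apply_ite]
    simp [mul_comm, mul_left_comm, add_comm]

theorem abs_directional_derivative_le {d m : ℕ} {K : Set (Pt d)} (hK : Convex ℝ K)
    {p : MvPolynomial (Fin d) ℝ} (hp : p.totalDegree ≤ m) {M : ℝ}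
    (hM : ∀ z ∈ K, |polyEval z p| ≤ M) {z y : Pt d} (hz : z ∈ K) (hy : y ∈ K) :
    |∑ k, (y - z) k * polyEval z (MvPolynomial.pderiv k p)| ≤ 2 * (m : ℝ) ^ 2 * M := by
  rw [← derivative_lineRestrict_eval_zero]
  refine abs_derivative_eval_zero_le (natDegree_lineRestrict_le _ _ hp) fun t ht => ?_
  rw [eval_lineRestrict]
  exact hM _ (hK.add_smul_sub_mem hz hy ht)

/-- Markov's inequality on a convex set with an inscribed ball. -/
theorem abs_polyEval_pderiv_le {d m : ℕ} {K : Set (Pt d)} (hK : Convex ℝ K) {b : Pt d} {σ : ℝ}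
    (hσ : 0 < σ) (hb : Metric.closedBall b σ ⊆ K)
    {p : MvPolynomial (Fin d) ℝ} (hp : p.totalDegree ≤ m) {M : ℝ}
    (hM : ∀ z ∈ K, |polyEval z p| ≤ M) {z : Pt d} (hz : z ∈ K) (k : Fin d) :
    |polyEval z (MvPolynomial.pderiv k p)| ≤ 2 * (m : ℝ) ^ 2 / σ * M := by
  -- The directional derivatives at `z` towards `b + σe_k` and `b - σe_k` differ by `2σ` times the
  -- `k`-th partial derivative, since the contribution of `b - z` cancels.
  have hmem : ∀ c : ℝ, |c| = σ → b + c • EuclideanSpace.single k (1 : ℝ) ∈ K := by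
    intro c hc
    apply hb
    simp [norm_smul, hc]
  have h1 := abs_directional_derivative_le hK hp hM hz (hmem σ (abs_of_pos hσ))
  have h2 := abs_directional_derivative_le hK hp hM hz (hmem (-σ) (by simp [abs_of_pos hσ]))
  set D := fun k => polyEval z (MvPolynomial.pderiv k p)
  have hdiff : ∑ l, (b + σ • EuclideanSpace.single k (1 : ℝ) - z) l * D l
      - ∑ l, (b + (-σ) • EuclideanSpace.single k (1 : ℝ) - z) l * D l = 2 * σ * D k := by
    rw [← Finset.sum_sub_distrib, Finset.sum_eq_single k]
    · simp; ring
    · intro l _ hl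
      simp [hl]
    · simp
  rw [abs_le] at h1 h2
  rw [div_mul_eq_mul_div, le_div_iff₀ hσ, ← abs_of_pos hσ, ← abs_mul, abs_le]
  constructor <;> nlinarith

theorem polyEval_sub {d : ℕ} (z : Pt d) (p q : MvPolynomial (Fin d) ℝ) :
    polyEval z (p - q) = polyEval z p - polyEval z q := by
  simp [polyEval]

theorem continuous_polyEval {d : ℕ} (p : MvPolynomial (Fin d) ℝ) :
    Continuous fun z : Pt d => polyEval z p := by
  unfold polyEval
  have := MvPolynomial.continuous_eval p
  fun_prop

/-- A set that meets all the balls obtained by contracting an inscribed ball towards the points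
of a compact convex set is a norming set for polynomials. -/
theorem abs_polyEval_le_two_mul {d m : ℕ} (hm : 0 < m) {K : Set (Pt d)} (hK : Convex ℝ K)
    (hKc : IsCompact K) {b : Pt d} {σ l : ℝ} (hb : Metric.closedBall b σ ⊆ K)
    (hl0 : 0 < l) (hl : l ≤ 3 / (32 * (m : ℝ) ^ 2)) {Y : Set (Pt d)}
    (hY : ∀ z ∈ K, ∃ w ∈ Metric.closedBall b σ, z + l • (w - z) ∈ Y)
    {p : MvPolynomial (Fin d) ℝ} (hp : p.totalDegree ≤ m) {M : ℝ}
    (hM : ∀ y ∈ Y, |polyEval y p| ≤ M) {z : Pt d} (hz : z ∈ K) :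
    |polyEval z p| ≤ 2 * M := by
  -- At a maximum point of `|p|`, moving the fraction `l` of the way to `w` changes `p` by at most
  -- half the maximum, so half of the maximum survives at a point of `Y`.
  obtain ⟨z₀, hz₀, hmax⟩ := hKc.exists_isMaxOn ⟨z, hz⟩
    (continuous_abs.comp (continuous_polyEval p)).continuousOn
  have hmax' : ∀ y ∈ K, |polyEval y p| ≤ |polyEval z₀ p| := fun y hy => hmax hy
  refine (hmax' z hz).trans ?_
  obtain ⟨w, hw, hwY⟩ := hY z₀ hz₀
  have hm1 : (1 : ℝ) ≤ m := by exact_mod_cast hm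
  have hm2 : (1 : ℝ) ≤ (m : ℝ) ^ 2 := by nlinarith
  rw [le_div_iff₀ (by positivity)] at hl
  have hl1 : l ≤ 3 / 32 := by nlinarith
  have h := abs_eval_sub_eval_zero_le (natDegree_lineRestrict_le z₀ (w - z₀) hp)
    (M := |polyEval z₀ p|) (l := l) (fun t ht => by
      rw [eval_lineRestrict]
      exact hmax' _ (hK.add_smul_sub_mem hz₀ (hb hw) ht)) hl0.le (by linarith)
  simp only [eval_lineRestrict, zero_smul, add_zero] at h
  have h3 : 2 * (m : ℝ) ^ 2 * |polyEval z₀ p| / (1 - l) * l ≤ 1 / 2 * |polyEval z₀ p| := by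
    rw [div_mul_eq_mul_div, div_le_iff₀ (by linarith)]
    nlinarith [abs_nonneg (polyEval z₀ p)]
  have h4 := abs_sub_abs_le_abs_sub (polyEval z₀ p) (polyEval (z₀ + l • (w - z₀)) p)
  rw [abs_sub_comm] at h4
  linarith [hM _ hwY]

theorem eq_zero_of_polyEval_eq_zero_on_ball {d : ℕ} {b : Pt d} {σ : ℝ} (hσ : 0 < σ)
    {p : MvPolynomial (Fin d) ℝ} (hp : ∀ z ∈ Metric.closedBall b σ, polyEval z p = 0) :
    p = 0 := by
  have hopen : IsOpen ((WithLp.toLp 2 : (Fin d → ℝ) → Pt d) ⁻¹' Metric.ball b σ) :=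
    Metric.isOpen_ball.preimage (PiLp.continuous_toLp 2 _)
  obtain ⟨ε, hε, hsub⟩ := Metric.isOpen_iff.1 hopen (WithLp.ofLp b) (by simpa using hσ)
  refine MvPolynomial.funext_set (fun k => Metric.ball (b k) ε) (fun k => ?_) fun x hx => ?_
  · rw [Real.ball_eq_Ioo]
    exact Set.Ioo_infinite (by linarith)
  · have hx' : x ∈ Metric.ball (WithLp.ofLp b) ε := by
      rw [ball_pi _ hε]
      exact hx
    simpa [polyEval] using hp _ (Metric.ball_subset_closedBall (hsub hx'))

/-! ### Cones and their inscribed balls -/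

/-- The truncated circular cone, described by inequalities. -/
def solidCone {d : ℕ} (a ξ : Pt d) (θ R : ℝ) : Set (Pt d) :=
  {z | ‖z - a‖ ≤ R ∧ Real.cos θ * ‖z - a‖ ≤ inner ℝ (z - a) ξ}

theorem convex_solidCone {d : ℕ} (a ξ : Pt d) {θ : ℝ} (hθ : 0 ≤ Real.cos θ) (R : ℝ) :
    Convex ℝ (solidCone a ξ θ R) := by
  rintro x ⟨hx1, hx2⟩ y ⟨hy1, hy2⟩ s t hs ht hst
  have he : s • x + t • y - a = s • (x - a) + t • (y - a) := by
    rw [smul_sub, smul_sub, sub_add_sub_comm, ← add_smul, hst, one_smul]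
  have hn : ‖s • (x - a) + t • (y - a)‖ ≤ s * ‖x - a‖ + t * ‖y - a‖ := by
    refine (norm_add_le _ _).trans ?_
    rw [norm_smul, norm_smul, Real.norm_of_nonneg hs, Real.norm_of_nonneg ht]
  constructor
  · rw [he]
    refine hn.trans ?_
    calc s * ‖x - a‖ + t * ‖y - a‖ ≤ s * R + t * R := by gcongr
      _ = R := by rw [← add_mul, hst, one_mul]
  · rw [he, inner_add_left, inner_smul_left, inner_smul_left]
    simp only [conj_trivial]
    nlinarith [mul_le_mul_of_nonneg_left hn hθ]

theorem isCompact_solidCone {d : ℕ} (a ξ : Pt d) (θ R : ℝ) :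
    IsCompact (solidCone a ξ θ R) := by
  refine (isCompact_closedBall a R).of_isClosed_subset ?_ fun z hz => by
    simpa [dist_eq_norm] using hz.1
  have h1 : IsClosed {z : Pt d | ‖z - a‖ ≤ R} := isClosed_le (by fun_prop) (by fun_prop)
  have h2 : IsClosed {z : Pt d | Real.cos θ * ‖z - a‖ ≤ inner ℝ (z - a) ξ} :=
    isClosed_le (by fun_prop) (by fun_prop)
  exact h1.inter h2

theorem solidCone_subset_cone {d : ℕ} {a ξ : Pt d} (hξ : ‖ξ‖ = 1) {θ R : ℝ} :
    solidCone a ξ θ R ⊆ cone a ξ θ R := by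
  rintro z ⟨h1, h2⟩
  rcases eq_or_ne z a with rfl | hne
  · exact ⟨ξ, 0, hξ, by simp [hξ, Real.cos_le_one], le_rfl, by simpa using h1, by simp⟩
  · have hpos : 0 < ‖z - a‖ := norm_pos_iff.2 (sub_ne_zero.2 hne)
    refine ⟨‖z - a‖⁻¹ • (z - a), ‖z - a‖, ?_, ?_, hpos.le, h1, ?_⟩
    · rw [norm_smul, norm_inv, norm_norm, inv_mul_cancel₀ hpos.ne']
    · rw [inner_smul_left, conj_trivial, inv_mul_eq_div, le_div_iff₀ hpos]
      exact h2
    · rw [smul_smul, mul_inv_cancel₀ hpos.ne', one_smul, add_sub_cancel]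

theorem cone_mono {d : ℕ} {a ξ : Pt d} {θ R R' : ℝ} (h : R ≤ R') :
    cone a ξ θ R ⊆ cone a ξ θ R' := by
  rintro z ⟨y, t, h1, h2, h3, h4, h5⟩
  exact ⟨y, t, h1, h2, h3, h4.trans h, h5⟩

theorem apex_mem_solidCone {d : ℕ} {a ξ : Pt d} {θ R : ℝ} (hR : 0 ≤ R) :
    a ∈ solidCone a ξ θ R := by
  simp [solidCone, hR]

/-- The inscribed ball of a truncated cone. -/
theorem closedBall_subset_solidCone {d : ℕ} {a ξ : Pt d} (hξ : ‖ξ‖ = 1) {θ ρ : ℝ} (hρ : 0 < ρ) :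
    Metric.closedBall (a + ρ • ξ) (ρ * Real.sin θ) ⊆
      solidCone a ξ θ (ρ * (1 + Real.sin θ)) := by
  intro z hz
  rw [mem_closedBall_iff_norm] at hz
  set w := z - a with hw
  have hzw : z - (a + ρ • ξ) = w - ρ • ξ := by rw [hw]; abel
  rw [hzw] at hz
  constructor
  · have : w = (w - ρ • ξ) + ρ • ξ := by abel
    calc ‖w‖ = ‖(w - ρ • ξ) + ρ • ξ‖ := by rw [← this]
      _ ≤ ‖w - ρ • ξ‖ + ‖ρ • ξ‖ := norm_add_le _ _
      _ ≤ ρ * Real.sin θ + ρ := by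
        rw [norm_smul, hξ, Real.norm_of_nonneg hρ.le, mul_one]; gcongr
      _ = _ := by ring
  · have h2 : ‖w - ρ • ξ‖ ^ 2 ≤ (ρ * Real.sin θ) ^ 2 := by gcongr
    rw [norm_sub_sq_real, inner_smul_right, norm_smul, hξ, Real.norm_of_nonneg hρ.le] at h2
    have h3 := Real.sin_sq_add_cos_sq θ
    -- `h2` says `2ρ⟪w, ξ⟫ ≥ ‖w‖² + ρ² cos² θ`, and the right side is at least `2ρ cos θ ‖w‖`.
    have h4 : 2 * ρ * (Real.cos θ * ‖w‖) ≤ 2 * ρ * inner ℝ w ξ := by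
      have : ρ ^ 2 * Real.sin θ ^ 2 = ρ ^ 2 * (1 - Real.cos θ ^ 2) := by rw [← h3]; ring
      nlinarith [sq_nonneg (‖w‖ - ρ * Real.cos θ)]
    exact le_of_mul_le_mul_left h4 (by positivity)

/-- Dilation by 2 about the apex undoes the passage from nodes to midpoints, so norming by midpoints
can be checked on nodes in the cone of twice the size. -/
theorem half_mem_solidCone {d : ℕ} {a ξ z : Pt d} {θ R : ℝ}
    (hz : z ∈ solidCone a ξ θ (R / 2)) : (2 : ℝ) • z - a ∈ solidCone a ξ θ R := by
  have he : (2 : ℝ) • z - a - a = (2 : ℝ) • (z - a) := by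
    rw [two_smul, two_smul]; abel
  constructor
  · rw [he, norm_smul]
    norm_num
    linarith [hz.1]
  · rw [he, norm_smul, inner_smul_left]
    norm_num
    linarith [hz.2]

/-! ### Geometry of the domain and of the nodes -/

theorem DomainCondition.sin_pos {d : ℕ} {Ω : Set (Pt d)} {r θ : ℝ} (h : DomainCondition Ω r θ) :
    0 < Real.sin θ :=
  Real.sin_pos_of_pos_of_lt_pi h.angle_pos (by linarith [h.angle_lt, Real.pi_pos])

theorem DomainCondition.cos_nonneg {d : ℕ} {Ω : Set (Pt d)} {r θ : ℝ}
    (h : DomainCondition Ω r θ) : 0 ≤ Real.cos θ :=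
  Real.cos_nonneg_of_neg_pi_div_two_le_of_le (by linarith [h.angle_pos, Real.pi_pos])
    h.angle_lt.le

theorem DomainCondition.coneConst_pos {d m : ℕ} (hm : 0 < m) {Ω : Set (Pt d)} {r θ : ℝ}
    (h : DomainCondition Ω r θ) : 0 < coneConst m θ := by
  have := h.sin_pos
  unfold coneConst
  positivity

/-- A domain with the cone condition lies in the closure of its interior. -/
theorem DomainCondition.mem_closure_interior {d : ℕ} {Ω : Set (Pt d)} {r θ : ℝ}
    (h : DomainCondition Ω r θ) {a : Pt d} (ha : a ∈ Ω) : a ∈ closure (interior Ω) := by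
  obtain ⟨ξ, hξ, hsub⟩ := h.cone_condition a ha
  have hs := h.sin_pos
  have hmem : ∀ ρ : ℝ, 0 < ρ → ρ * (1 + Real.sin θ) ≤ r → a + ρ • ξ ∈ interior Ω := by
    intro ρ hρ hle
    refine mem_interior.2 ⟨Metric.ball (a + ρ • ξ) (ρ * Real.sin θ), ?_, Metric.isOpen_ball,
      Metric.mem_ball_self (by positivity)⟩
    exact Metric.ball_subset_closedBall.trans <|
      (closedBall_subset_solidCone hξ hρ).trans <|
      (solidCone_subset_cone hξ).trans <| (cone_mono hle).trans hsub
  rw [Metric.mem_closure_iff]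
  intro ε hε
  refine ⟨_, hmem (min (ε / 2) (r / (1 + Real.sin θ))) ?_ ?_, ?_⟩
  · have := h.radius_pos
    positivity
  · rw [← le_div_iff₀ (by linarith)]
    exact min_le_right _ _
  · have hpos : 0 < min (ε / 2) (r / (1 + Real.sin θ)) := by
      have := h.radius_pos
      positivity
    rw [dist_self_add_right, norm_smul, hξ, Real.norm_of_nonneg hpos.le, mul_one]
    exact (min_le_left _ _).trans_lt (by linarith)

/-- The axis of the cone is a nondegenerate segment in `Ω`. Finitely many nodes therefore cannot
exhaust `Ω`, which makes the fill distance positive. -/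
theorem DomainCondition.infinite {d : ℕ} {Ω : Set (Pt d)} {r θ : ℝ}
    (h : DomainCondition Ω r θ) {a : Pt d} (ha : a ∈ Ω) : Ω.Infinite := by
  obtain ⟨ξ, hξ, hsub⟩ := h.cone_condition a ha
  have hinj : Set.InjOn (fun t : ℝ => a + t • ξ) (Set.Icc 0 r) := by
    intro s _ t _ hst
    have hst' : s • ξ = t • ξ := by simpa using hst
    exact smul_left_injective ℝ (norm_ne_zero_iff.1 (by rw [hξ]; exact one_ne_zero)) hst'
  refine ((Set.Icc_infinite h.radius_pos).image hinj).mono ?_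
  rintro _ ⟨t, ht, rfl⟩
  exact hsub ⟨ξ, t, hξ, by simp [hξ, Real.cos_le_one], ht.1, ht.2, rfl⟩

theorem infDist_le_fillDistance {d N : ℕ} {x : Fin N → Pt d} {Ω : Set (Pt d)} (hΩ : IsCompact Ω)
    {z : Pt d} (hz : z ∈ Ω) : Metric.infDist z (Set.range x) ≤ fillDistance x Ω :=
  le_csSup (hΩ.image (Metric.continuous_infDist_pt _)).bddAbove ⟨z, hz, rfl⟩

theorem exists_dist_le_fillDistance {d N : ℕ} {x : Fin N → Pt d} {Ω : Set (Pt d)}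
    (hΩ : IsCompact Ω) (i : Fin N) {z : Pt d} (hz : z ∈ Ω) :
    ∃ j, dist z (x j) ≤ fillDistance x Ω := by
  obtain ⟨_, ⟨j, rfl⟩, hj⟩ := (Set.finite_range x).isCompact.exists_infDist_eq_dist
    ⟨x i, i, rfl⟩ z
  exact ⟨j, hj ▸ infDist_le_fillDistance hΩ hz⟩

theorem NodeCondition.fillDistance_pos {d N m : ℕ} {Ω : Set (Pt d)} {r θ c : ℝ}
    {x : Fin N → Pt d} (hΩ : DomainCondition Ω r θ) (hx : NodeCondition Ω r θ m c x)
    (i : Fin N) : 0 < fillDistance x Ω := by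
  by_contra hle
  refine hΩ.infinite (hx.mem i) ((Set.finite_range x).subset fun z hz => ?_)
  obtain ⟨j, hj⟩ := exists_dist_le_fillDistance hΩ.compact i hz
  exact ⟨j, (dist_le_zero.1 (hj.trans (not_lt.1 hle))).symm⟩

theorem two_mul_separationDistance_le {d N : ℕ} (x : Fin N → Pt d) {i j : Fin N} (hij : i ≠ j) :
    2 * separationDistance x ≤ dist (x i) (x j) := by
  have : sInf {c : ℝ | ∃ i j : Fin N, i ≠ j ∧ c = dist (x i) (x j)} ≤ dist (x i) (x j) :=
    csInf_le ⟨0, by rintro _ ⟨i, j, _, rfl⟩; exact dist_nonneg⟩ ⟨i, j, hij, rfl⟩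
  unfold separationDistance
  linarith

theorem separationDistance_nonneg {d N : ℕ} (x : Fin N → Pt d) : 0 ≤ separationDistance x := by
  have : 0 ≤ sInf {c : ℝ | ∃ i j : Fin N, i ≠ j ∧ c = dist (x i) (x j)} :=
    Real.sInf_nonneg (by rintro _ ⟨i, j, _, rfl⟩; exact dist_nonneg)
  unfold separationDistance
  linarith

theorem NodeCondition.const_pos {d N m : ℕ} {Ω : Set (Pt d)} {r θ c : ℝ}
    {x : Fin N → Pt d} (hΩ : DomainCondition Ω r θ) (hx : NodeCondition Ω r θ m c x)
    (i : Fin N) : 0 < c := by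
  have h1 := hx.fillDistance_pos hΩ i
  have h2 := hx.fill_le_sep
  have h3 := separationDistance_nonneg x
  by_contra hc
  nlinarith [not_lt.1 hc]

/-! ### The norming cone at a node -/

/-- The midpoints of the edges to the nodes of a cone form a norming set: a polynomial of degree
at most `m` is controlled, together with its derivatives at the apex, by its values there. -/
theorem NodeCondition.exists_norming_cone {d N m : ℕ} (hm : 0 < m) {Ω : Set (Pt d)} {r θ c : ℝ}
    {x : Fin N → Pt d} (hΩ : DomainCondition Ω r θ) (hx : NodeCondition Ω r θ m c x)
    (i : Fin N) :
    ∃ (K : Set (Pt d)) (b : Pt d) (σ : ℝ), Convex ℝ K ∧ x i ∈ K ∧ 0 < σ ∧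
      2 * (m : ℝ) ^ 2 / σ ≤ 1 / fillDistance x Ω ∧ Metric.closedBall b σ ⊆ K ∧
      ∀ (p : MvPolynomial (Fin d) ℝ), p.totalDegree ≤ m → ∀ M : ℝ,
        (∀ j, ‖x j - x i‖ ≤ coneConst m θ * fillDistance x Ω →
          |polyEval (edgeMid x i j) p| ≤ M) →
        ∀ z ∈ K, |polyEval z p| ≤ 2 * M := by
  obtain ⟨ξ, hξ, hsub⟩ := hΩ.cone_condition (x i) (hx.mem i)
  have hs := hΩ.sin_pos
  have hs1 := Real.sin_le_one θ
  have hC := hΩ.coneConst_pos hm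
  have hh := hx.fillDistance_pos hΩ i
  have hfill := hx.fill_le
  set s := Real.sin θ
  set h := fillDistance x Ω
  have hmpos : (0 : ℝ) < m := by exact_mod_cast hm
  rw [le_div_iff₀ hC] at hfill
  set R := coneConst m θ * h with hR
  have hRpos : 0 < R := by positivity
  set ρ := R / (1 + s) with hρ
  have hρpos : 0 < ρ := by positivity
  have hρR : ρ * (1 + s) = R := by rw [hρ]; field_simp
  have hball : Metric.closedBall (x i + ρ • ξ) (ρ * s) ⊆ solidCone (x i) ξ θ R := by
    rw [← hρR]
    exact closedBall_subset_solidCone hξ hρpos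
  have hball2 : Metric.closedBall (x i + (ρ / 2) • ξ) (ρ / 2 * s)
      ⊆ solidCone (x i) ξ θ (R / 2) := by
    have : R / 2 = ρ / 2 * (1 + s) := by rw [← hρR]; ring
    rw [this]
    exact closedBall_subset_solidCone hξ (half_pos hρpos)
  have hΩK : solidCone (x i) ξ θ R ⊆ Ω :=
    (solidCone_subset_cone hξ).trans ((cone_mono (by linarith)).trans hsub)
  -- The constant `C(θ)` is designed for this radius: the ratio `l = h / (ρ s)` becomes `3s / (16(1
  -- + s)m²)`, and `s ≤ 1` gives `l ≤ 3/(32m²)`.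
  have hρs : ρ * s = 16 * (1 + s) * (m : ℝ) ^ 2 / (3 * s) * h := by
    change R / (1 + s) * s = _
    rw [hR, show coneConst m θ = 16 * (1 + s) ^ 2 * (m : ℝ) ^ 2 / (3 * s ^ 2) from rfl]
    field_simp
  -- Contraction by `l` shrinks the inscribed ball to radius exactly `h`, so the contracted ball
  -- must contain a node.
  set l := h / (ρ * s) with hl
  have hlpos : 0 < l := by positivity
  have hle : l ≤ 3 / (32 * (m : ℝ) ^ 2) := by
    have : l = 3 * s / (16 * (1 + s) * (m : ℝ) ^ 2) := by
      rw [hl, hρs]; field_simp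
    rw [this, div_le_div_iff₀ (by positivity) (by positivity)]
    nlinarith [mul_nonneg (sq_nonneg (m : ℝ)) (sub_nonneg.2 hs1)]
  have hl1 : l ≤ 1 := by
    refine hle.trans ?_
    rw [div_le_one (by positivity)]
    have : (1 : ℝ) ≤ m := by exact_mod_cast hm
    nlinarith
  refine ⟨solidCone (x i) ξ θ (R / 2), x i + (ρ / 2) • ξ, ρ / 2 * s,
    convex_solidCone _ _ hΩ.cos_nonneg _, apex_mem_solidCone (by positivity), by positivity,
    ?_, hball2, ?_⟩
  · have : ρ / 2 * s = 8 * (1 + s) * (m : ℝ) ^ 2 / (3 * s) * h := by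
      rw [div_mul_eq_mul_div, hρs]; ring
    rw [this, div_le_div_iff₀ (by positivity) hh]
    have : 2 * (m : ℝ) ^ 2 ≤ 8 * (1 + s) * (m : ℝ) ^ 2 / (3 * s) := by
      rw [le_div_iff₀ (by positivity)]
      nlinarith [mul_nonneg (sq_nonneg (m : ℝ)) (sub_nonneg.2 hs1)]
    nlinarith
  · intro p hp M hM z hz
    refine abs_polyEval_le_two_mul hm (convex_solidCone _ _ hΩ.cos_nonneg _)
      (isCompact_solidCone _ _ _ _) hball2 hlpos hle
      (Y := {y | ∃ j, ‖x j - x i‖ ≤ R ∧ y = edgeMid x i j}) ?_ hp ?_ hz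
    · intro z hz
      have hz2 := half_mem_solidCone hz
      set z2 := (2 : ℝ) • z - x i with hz2d
      have hcen : z2 + l • (x i + ρ • ξ - z2) ∈ Ω := hΩK <|
        (convex_solidCone _ _ hΩ.cos_nonneg _).add_smul_sub_mem hz2
          (hball (Metric.mem_closedBall_self (by positivity))) ⟨hlpos.le, hl1⟩
      obtain ⟨j, hj⟩ := exists_dist_le_fillDistance (x := x) hΩ.compact i hcen
      -- The preimage of the node under the contraction. It lies in the inscribed ball, so convexity
      -- places the node itself in the cone.
      set w2 := z2 + l⁻¹ • (x j - z2) with hw2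
      have hxj : x j = z2 + l • (w2 - z2) := by
        rw [hw2, add_sub_cancel_left, smul_smul, mul_inv_cancel₀ hlpos.ne', one_smul,
          add_sub_cancel]
      have hw2b : w2 ∈ Metric.closedBall (x i + ρ • ξ) (ρ * s) := by
        rw [mem_closedBall_iff_norm]
        have e : x j - (z2 + l • (x i + ρ • ξ - z2)) = l • (w2 - (x i + ρ • ξ)) := by
          conv_lhs => rw [hxj]
          simp only [smul_sub]
          abel
        rw [dist_comm, dist_eq_norm, e, norm_smul, Real.norm_of_nonneg hlpos.le] at hj
        have : h = l * (ρ * s) := by rw [hl]; field_simp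
        exact le_of_mul_le_mul_left (this ▸ hj) hlpos
      have hxjK : x j ∈ solidCone (x i) ξ θ R := by
        rw [hxj]
        exact (convex_solidCone _ _ hΩ.cos_nonneg _).add_smul_sub_mem hz2 (hball hw2b)
          ⟨hlpos.le, hl1⟩
      refine ⟨(1 / 2 : ℝ) • (x i + w2), ?_, j, hxjK.1, ?_⟩
      · rw [mem_closedBall_iff_norm] at hw2b ⊢
        have e : (1 / 2 : ℝ) • (x i + w2) - (x i + (ρ / 2) • ξ)
            = (1 / 2 : ℝ) • (w2 - (x i + ρ • ξ)) := by module
        rw [e, norm_smul]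
        norm_num
        linarith
      · rw [edgeMid, hxj, hz2d]
        module
    · rintro y ⟨j, hj, rfl⟩
      exact hM j hj

/-! ### Symmetry of higher derivatives, up to the boundary -/

section Symmetry

variable {E F : Type*} [NormedAddCommGroup E] [NormedSpace ℝ E]
  [NormedAddCommGroup F] [NormedSpace ℝ F]

/-- Exchanging the first two arguments is the symmetry of the second derivative of the iterated
derivative two orders lower. Any other adjacent exchange leaves the first argument alone and passes
under the outermost derivative by induction, because the identity holds near `z`. Adjacent exchanges
generate all permutations. -/
theorem ContDiffAt.iteratedFDeriv_swap_castSucc_succ {f : E → F} {k : ℕ} {z : E}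
    (hf : ContDiffAt ℝ ((k + 1 : ℕ) : WithTop ℕ∞) f z) (i : Fin k) (v : Fin (k + 1) → E) :
    iteratedFDeriv ℝ (k + 1) f z (v ∘ Equiv.swap i.castSucc i.succ)
      = iteratedFDeriv ℝ (k + 1) f z v := by
  induction k generalizing z with
  | zero => exact i.elim0
  | succ k ih =>
    have hev : ∀ᶠ w in nhds z, ContDiffAt ℝ ((k + 1 + 1 : ℕ) : WithTop ℕ∞) f w :=
      hf.eventually (by simp)
    have hd : DifferentiableAt ℝ (iteratedFDeriv ℝ (k + 1) f) z :=
      hf.differentiableAt_iteratedFDeriv (by exact_mod_cast Nat.lt_succ_self _)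
    have hstep : ∀ u : Fin (k + 1 + 1) → E, iteratedFDeriv ℝ (k + 1 + 1) f z u
        = fderiv ℝ (fun w => iteratedFDeriv ℝ (k + 1) f w (Fin.tail u)) z (u 0) := by
      intro u
      rw [iteratedFDeriv_succ_apply_left]
      have := (hd.hasFDerivAt.continuousMultilinear_apply_const (Fin.tail u)).fderiv
      rw [this]
      rfl
    rw [hstep, hstep]
    induction i using Fin.cases with
    | zero =>
      have hG : ContDiffAt ℝ 2 (iteratedFDeriv ℝ k f) z :=
        hf.iteratedFDeriv_right (by norm_cast; omega)
      have hsymm := (hG.isSymmSndFDerivAt (by simp)).eq (v 0) (v 1)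
      have hdd : DifferentiableAt ℝ (fderiv ℝ (iteratedFDeriv ℝ k f)) z :=
        (hG.fderiv_right (m := 1) (by norm_num)).differentiableAt (by simp)
      have hsnd : ∀ u : Fin (k + 1 + 1) → E,
          fderiv ℝ (fun w => iteratedFDeriv ℝ (k + 1) f w (Fin.tail u)) z (u 0)
            = fderiv ℝ (fderiv ℝ (iteratedFDeriv ℝ k f)) z (u 0) (u 1)
                (Fin.tail (Fin.tail u)) := by
        intro u
        have h1 : (fun w => iteratedFDeriv ℝ (k + 1) f w (Fin.tail u))
            = fun w => fderiv ℝ (iteratedFDeriv ℝ k f) w (u 1) (Fin.tail (Fin.tail u)) := by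
          funext w
          rw [iteratedFDeriv_succ_apply_left]
          rfl
        rw [h1]
        have h2 := ((hdd.hasFDerivAt.clm_apply (hasFDerivAt_const (u 1) z))
          |>.continuousMultilinear_apply_const (Fin.tail (Fin.tail u))).fderiv
        rw [h2]
        simp
      rw [hsnd, hsnd]
      have e0 : (v ∘ Equiv.swap (0 : Fin (k + 1)).castSucc (0 : Fin (k + 1)).succ) 0 = v 1 := by
        simp
      have e1 : (v ∘ Equiv.swap (0 : Fin (k + 1)).castSucc (0 : Fin (k + 1)).succ) 1 = v 0 := by
        simp
      have e2 : Fin.tail (Fin.tail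
          (v ∘ Equiv.swap (0 : Fin (k + 1)).castSucc (0 : Fin (k + 1)).succ))
          = Fin.tail (Fin.tail v) := by
        funext j
        simp [Fin.tail, Equiv.swap_apply_of_ne_of_ne, Fin.ext_iff]
      rw [e0, e1, e2, hsymm]
    | succ i =>
      have h0 : (v ∘ Equiv.swap i.succ.castSucc i.succ.succ) 0 = v 0 := by
        simp [Equiv.swap_apply_of_ne_of_ne, Fin.ext_iff]
      have ht : Fin.tail (v ∘ Equiv.swap i.succ.castSucc i.succ.succ)
          = Fin.tail v ∘ Equiv.swap i.castSucc i.succ := by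
        funext j
        simp only [Fin.tail, Function.comp]
        congr 1
        simp only [Equiv.swap_apply_def]
        split_ifs <;> simp_all [Fin.ext_iff]
      rw [h0, ht]
      congr 1
      apply Filter.EventuallyEq.fderiv_eq
      filter_upwards [hev] with w hw
      exact ih (hw.of_le (by exact_mod_cast Nat.le_succ _)) i (Fin.tail v)

/-- The iterated derivative of order `k` of a function of class `C^k` is symmetric. -/
theorem ContDiffAt.iteratedFDeriv_comp_equiv {f : E → F} {k : ℕ} {z : E}
    (hf : ContDiffAt ℝ (k : WithTop ℕ∞) f z) (σ : Equiv.Perm (Fin k)) (v : Fin k → E) :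
    iteratedFDeriv ℝ k f z (v ∘ σ) = iteratedFDeriv ℝ k f z v := by
  cases k with
  | zero => congr 1; exact Subsingleton.elim _ _
  | succ k =>
    have hσ : σ ∈ Submonoid.closure
        (Set.range fun i : Fin k => Equiv.swap i.castSucc i.succ) := by
      rw [Equiv.Perm.mclosure_swap_castSucc_succ]
      trivial
    induction hσ using Submonoid.closure_induction generalizing v with
    | mem τ hτ =>
      obtain ⟨i, rfl⟩ := hτ
      exact ContDiffAt.iteratedFDeriv_swap_castSucc_succ hf i v
    | one => rfl
    | mul τ τ' _ _ h1 h2 =>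
      rw [Equiv.Perm.coe_mul, ← Function.comp_assoc, h2, h1]

/-- In the interior the derivatives within `S` are ordinary ones, hence symmetric; continuity on `S`
carries the identity to limits of interior points. -/
theorem ContDiffOn.iteratedFDerivWithin_comp_equiv {f : E → F} {S : Set E} {n k : ℕ} {a : E}
    (hf : ContDiffOn ℝ (n : WithTop ℕ∞) f S) (hS : UniqueDiffOn ℝ S) (hk : k ≤ n)
    (ha : a ∈ S) (ha' : a ∈ closure (interior S)) (σ : Equiv.Perm (Fin k)) (v : Fin k → E) :
    iteratedFDerivWithin ℝ k f S a (v ∘ σ) = iteratedFDerivWithin ℝ k f S a v := by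
  have hcont := hf.continuousOn_iteratedFDerivWithin (m := k) (by exact_mod_cast hk) hS
  have heq : Set.EqOn (fun z => iteratedFDerivWithin ℝ k f S z (v ∘ σ))
      (fun z => iteratedFDerivWithin ℝ k f S z v) (interior S) := by
    intro z hz
    have hz' : S ∈ nhds z := mem_interior_iff_mem_nhds.1 hz
    have hfz : ContDiffAt ℝ (k : WithTop ℕ∞) f z :=
      (hf.contDiffAt hz').of_le (by exact_mod_cast hk)
    have : iteratedFDerivWithin ℝ k f S z = iteratedFDeriv ℝ k f z :=
      iteratedFDerivWithin_eq_iteratedFDeriv hS hfz (interior_subset hz)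
    simp only [this]
    exact ContDiffAt.iteratedFDeriv_comp_equiv hfz σ v
  have hc : ∀ u : Fin k → E, ContinuousOn (fun z => iteratedFDerivWithin ℝ k f S z u) S :=
    fun u => (ContinuousMultilinearMap.apply ℝ (fun _ : Fin k => E) F u).continuous.comp_continuousOn
      hcont
  have h1 := heq.of_subset_closure ((hc _).mono (Set.inter_subset_left (t := closure (interior S))))
    ((hc _).mono Set.inter_subset_left) (s := interior S) (t := S ∩ closure (interior S))
    (Set.subset_inter interior_subset subset_closure) Set.inter_subset_right
  exact h1 ⟨ha, ha'⟩

end Symmetry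

/-! ### Taylor expansion within a set -/

section Taylor

variable {E F : Type*} [NormedAddCommGroup E] [NormedSpace ℝ E]
  [NormedAddCommGroup F] [NormedSpace ℝ F]

/-- The Taylor polynomial of order `m` at `a`, built from the derivatives within `S`. -/
def taylorWithinSet (m : ℕ) (f : E → F) (S : Set E) (a z : E) : F :=
  ∑ k ∈ Finset.range (m + 1),
    (k.factorial : ℝ)⁻¹ • iteratedFDerivWithin ℝ k f S a (fun _ => z - a)

theorem contDiff_diagonal {k : ℕ} (g : ContinuousMultilinearMap ℝ (fun _ : Fin k => E) F) (a : E)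
    {n : WithTop ℕ∞} : ContDiff ℝ n (fun z => g (fun _ => z - a)) :=
  g.contDiff.comp (contDiff_pi.2 fun _ => contDiff_id.sub contDiff_const)

theorem contDiff_taylorWithinSet (m : ℕ) (f : E → F) (S : Set E) (a : E) {n : WithTop ℕ∞} :
    ContDiff ℝ n (taylorWithinSet m f S a) :=
  ContDiff.sum fun _ _ => contDiff_const.smul (contDiff_diagonal _ a)

/-- Differentiating a finite power series at its centre sums its coefficient over all permutations
of the arguments. By symmetry the `k!` terms agree and cancel the factor `1/k!`. -/
theorem iteratedFDeriv_taylorWithinSet_center {m : ℕ} {f : E → F} {S : Set E} {a : E}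
    (hf : ContDiffOn ℝ (m : WithTop ℕ∞) f S) (hS : UniqueDiffOn ℝ S)
    (ha : a ∈ S) (ha' : a ∈ closure (interior S)) {k : ℕ} (hk : k ≤ m) :
    iteratedFDeriv ℝ k (taylorWithinSet m f S a) a = iteratedFDerivWithin ℝ k f S a := by
  let q : FormalMultilinearSeries ℝ E F := fun k =>
    if k < m + 1 then (k.factorial : ℝ)⁻¹ • iteratedFDerivWithin ℝ k f S a else 0
  have hq : HasFiniteFPowerSeriesOnBall (taylorWithinSet m f S a) q a (m + 1) ⊤ := by
    apply HasFiniteFPowerSeriesOnBall.mk'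
    · intro l hl
      exact if_neg (by omega)
    · simp
    · intro y _
      rw [taylorWithinSet]
      refine Finset.sum_congr rfl fun l hl => ?_
      simp only [q, if_pos (Finset.mem_range.1 hl), add_sub_cancel_left]
      rfl
  ext v
  have han : AnalyticOn ℝ (taylorWithinSet m f S a) Set.univ :=
    (contDiff_taylorWithinSet m f S a (n := ⊤)).contDiffOn.analyticOn
  rw [hq.toHasFPowerSeriesOnBall.iteratedFDeriv_eq_sum han]
  have : ∀ σ : Equiv.Perm (Fin k), q k (fun i => v (σ i))
      = (k.factorial : ℝ)⁻¹ • iteratedFDerivWithin ℝ k f S a v := by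
    intro σ
    simp only [q, if_pos (Nat.lt_succ_of_le hk)]
    rw [← ContDiffOn.iteratedFDerivWithin_comp_equiv hf hS hk ha ha' σ v]
    rfl
  rw [Finset.sum_congr rfl fun σ _ => this σ, Finset.sum_const, Finset.card_univ,
    Fintype.card_perm, Fintype.card_fin, ← Nat.cast_smul_eq_nsmul ℝ, smul_smul,
    mul_inv_cancel₀ (by exact_mod_cast k.factorial_ne_zero), one_smul]

/-- The `k`-th derivative of a form of degree `k` does not depend on the point, so all later ones
vanish. -/
theorem iteratedFDeriv_diagonal_eq_zero {k n : ℕ} (hkn : k < n)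
    (g : ContinuousMultilinearMap ℝ (fun _ : Fin k => E) F) (a : E) :
    iteratedFDeriv ℝ n (fun z => g (fun _ => z - a)) = 0 := by
  induction n, hkn using Nat.le_induction with
  | base =>
    have h1 : ∀ z, iteratedFDeriv ℝ k (fun z => g (fun _ => z - a)) z
        = iteratedFDeriv ℝ k (fun z => g (fun _ => z - a)) a := by
      intro z
      have h2 := iteratedFDeriv_comp_sub (𝕜 := ℝ) (f := fun z => g (fun _ => z)) k a
      ext v
      rw [h2 z, h2 a]
      simp only [g.iteratedFDeriv_comp_diagonal]
    funext z
    ext v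
    rw [iteratedFDeriv_succ_apply_left, funext h1]
    simp
  | succ n _ ih =>
    funext z
    ext v
    rw [iteratedFDeriv_succ_apply_left, ih]
    simp

theorem iteratedFDeriv_taylorWithinSet_of_lt {m n : ℕ} (hmn : m < n) (f : E → F) (S : Set E)
    (a : E) : iteratedFDeriv ℝ n (taylorWithinSet m f S a) = 0 := by
  have : taylorWithinSet m f S a = fun z => ∑ k ∈ Finset.range (m + 1),
      ((k.factorial : ℝ)⁻¹ • iteratedFDerivWithin ℝ k f S a) (fun _ => z - a) := rfl
  rw [this]
  funext z
  rw [iteratedFDeriv_fun_sum_apply fun i _ => (contDiff_diagonal _ a).contDiffAt]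
  refine Finset.sum_eq_zero fun k hk => ?_
  rw [iteratedFDeriv_diagonal_eq_zero (by have := Finset.mem_range.1 hk; omega)]
  rfl

/-- The mean value inequality along a Lipschitz curve. -/
theorem norm_comp_curve_le {f : E → F} {S : Set E} (hf : DifferentiableOn ℝ f S) {γ : ℝ → E}
    {L B : ℝ} (hL : 0 ≤ L) (hγS : ∀ t ∈ Set.Icc (0 : ℝ) 1, γ t ∈ S)
    (hγ : ∀ s ∈ Set.Icc (0 : ℝ) 1, ∀ t ∈ Set.Icc (0 : ℝ) 1, dist (γ s) (γ t) ≤ L * |s - t|)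
    (hB : ∀ t ∈ Set.Icc (0 : ℝ) 1, ‖fderivWithin ℝ f S (γ t)‖ ≤ B) (h0 : f (γ 0) = 0) :
    ∀ t ∈ Set.Icc (0 : ℝ) 1, ‖f (γ t)‖ ≤ B * L := by
  have hB0 : 0 ≤ B := (norm_nonneg _).trans (hB 0 (by simp))
  have hγc : ContinuousOn γ (Set.Icc 0 1) := by
    refine LipschitzOnWith.continuousOn (K := L.toNNReal) ?_
    refine LipschitzOnWith.of_dist_le_mul fun s hs t ht => ?_
    rw [Real.coe_toNNReal _ hL, Real.dist_eq]
    exact hγ s hs t ht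
  have hcont : ContinuousOn (f ∘ γ) (Set.Icc 0 1) := hf.continuousOn.comp hγc hγS
  -- The curve is only Lipschitz, so `f ∘ γ` need not be differentiable; bounds on right slopes are
  -- used instead. The slack `e` supplies the strict inequality required by the comparison theorem.
  suffices h : ∀ e > 0, ∀ t ∈ Set.Icc (0 : ℝ) 1, ‖f (γ t)‖ ≤ (B * L + e) * t by
    intro t ht
    refine le_of_forall_pos_le_add fun e he => (h e he t ht).trans ?_
    have : 0 ≤ B * L + e := by positivity
    nlinarith [ht.2]
  intro e he t ht
  refine image_norm_le_of_liminf_right_slope_norm_lt_deriv_boundary (f := f ∘ γ)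
    (f' := fun _ => B * L) (B := fun t => (B * L + e) * t) (B' := fun _ => B * L + e)
    hcont ?_ (by simp [h0]) (by fun_prop) ?_ (fun _ _ _ => by linarith) ht
  · intro s hs r hr
    have hs' : s ∈ Set.Icc (0 : ℝ) 1 := Set.Ico_subset_Icc_self hs
    obtain ⟨η, hη, hηr⟩ : ∃ η > 0, (B + η) * L < r := by
      rcases hL.eq_or_lt with rfl | hLpos
      · exact ⟨1, one_pos, by simpa using hr⟩
      · refine ⟨(r - B * L) / (2 * L), by have := sub_pos.2 hr; positivity, ?_⟩
        have : (r - B * L) / (2 * L) * L = (r - B * L) / 2 := by field_simp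
        rw [add_mul, this]
        linarith
    have hder := (hf _ (hγS s hs')).hasFDerivWithinAt
    have hlo := (hasFDerivWithinAt_iff_isLittleO.1 hder).def hη
    have htend : Filter.Tendsto γ (nhdsWithin s (Set.Ioi s)) (nhdsWithin (γ s) S) := by
      have h1 : ContinuousWithinAt γ (Set.Icc 0 1) s := hγc s hs'
      have h2 : nhdsWithin s (Set.Ioi s) ≤ nhdsWithin s (Set.Icc 0 1) := by
        rw [← nhdsWithin_Ioo_eq_nhdsGT hs.2]
        exact nhdsWithin_mono _ fun u hu => ⟨hs.1.trans hu.1.le, hu.2.le⟩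
      refine tendsto_nhdsWithin_iff.2 ⟨h1.tendsto.mono_left h2, ?_⟩
      exact h2 (Filter.eventually_of_mem self_mem_nhdsWithin hγS)
    refine Filter.Eventually.frequently ?_
    filter_upwards [htend.eventually hlo, self_mem_nhdsWithin,
      Ioo_mem_nhdsGT hs.2] with u hu hsu hu1
    have hsu' : 0 < u - s := sub_pos.2 hsu
    have hu01 : u ∈ Set.Icc (0 : ℝ) 1 := ⟨hs.1.trans hu1.1.le, hu1.2.le⟩
    have hd : ‖γ u - γ s‖ ≤ L * (u - s) := by
      have := hγ u hu01 s hs'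
      rwa [dist_eq_norm, abs_of_pos hsu'] at this
    have hlin : ‖fderivWithin ℝ f S (γ s) (γ u - γ s)‖ ≤ B * ‖γ u - γ s‖ :=
      (ContinuousLinearMap.le_opNorm _ _).trans
        (mul_le_mul_of_nonneg_right (hB s hs') (norm_nonneg _))
    have hmain : ‖f (γ u)‖ - ‖f (γ s)‖ ≤ (B + η) * L * (u - s) := by
      have e1 : f (γ u) - f (γ s) = (f (γ u) - f (γ s) - fderivWithin ℝ f S (γ s) (γ u - γ s))
        + fderivWithin ℝ f S (γ s) (γ u - γ s) := by abel
      calc ‖f (γ u)‖ - ‖f (γ s)‖ ≤ ‖f (γ u) - f (γ s)‖ := norm_sub_norm_le _ _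
        _ ≤ η * ‖γ u - γ s‖ + B * ‖γ u - γ s‖ := by
          rw [e1]; exact (norm_add_le _ _).trans (add_le_add hu hlin)
        _ = (B + η) * ‖γ u - γ s‖ := by ring
        _ ≤ (B + η) * (L * (u - s)) := by gcongr
        _ = _ := by ring
    rw [slope_def_field, div_lt_iff₀ hsu']
    simp only [Function.comp]
    nlinarith
  · intro s _
    simpa using ((hasDerivAt_id s).const_mul (B * L + e)).hasDerivWithinAt

/-- A function whose derivatives of order at most `n` vanish at the origin of a short curve is
small at the end of the curve. -/
theorem norm_le_of_iteratedFDerivWithin_eq_zero {n : ℕ} {f : E → F} {S : Set E}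
    (hf : ContDiffOn ℝ ((n + 1 : ℕ) : WithTop ℕ∞) f S) (hS : UniqueDiffOn ℝ S) {γ : ℝ → E}
    {L B : ℝ} (hL : 0 ≤ L) (hγS : ∀ t ∈ Set.Icc (0 : ℝ) 1, γ t ∈ S)
    (hγ : ∀ s ∈ Set.Icc (0 : ℝ) 1, ∀ t ∈ Set.Icc (0 : ℝ) 1, dist (γ s) (γ t) ≤ L * |s - t|)
    (hB : ∀ z ∈ S, ‖iteratedFDerivWithin ℝ (n + 1) f S z‖ ≤ B)
    (h0 : ∀ k ≤ n, iteratedFDerivWithin ℝ k f S (γ 0) = 0) :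
    ‖f (γ 1)‖ ≤ B * L ^ (n + 1) := by
  -- Descent from the top derivative: each integration along the curve lowers the order by one and
  -- costs a factor `L`.
  have key : ∀ j ≤ n + 1, ∀ t ∈ Set.Icc (0 : ℝ) 1,
      ‖iteratedFDerivWithin ℝ (n + 1 - j) f S (γ t)‖ ≤ B * L ^ j := by
    intro j hj
    induction j with
    | zero => intro t ht; simpa using hB _ (hγS t ht)
    | succ j ih =>
      have e : n + 1 - (j + 1) + 1 = n + 1 - j := by omega
      rw [pow_succ, ← mul_assoc]
      refine norm_comp_curve_le (f := iteratedFDerivWithin ℝ (n + 1 - (j + 1)) f S)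
        (hf.differentiableOn_iteratedFDerivWithin (by norm_cast; omega) hS)
        hL hγS hγ (fun t ht => ?_) (h0 _ (by omega))
      rw [norm_fderivWithin_iteratedFDerivWithin, e]
      exact ih (by omega) t ht
  have := key (n + 1) le_rfl 1 (by simp)
  rw [Nat.sub_self, norm_iteratedFDerivWithin_zero] at this
  exact this

end Taylor

/-! ### The `C^n` norm and a uniform Taylor bound -/

theorem bddAbove_ckNorm_set {d n : ℕ} {S : Set (Pt d)} (hc : IsCompact S) (hS : UniqueDiffOn ℝ S)
    {φ : Pt d → ℝ} (hφ : ContDiffOn ℝ (n : WithTop ℕ∞) φ S) :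
    BddAbove {c : ℝ | ∃ k ≤ n, ∃ z ∈ S, c = ‖iteratedFDerivWithin ℝ k φ S z‖} := by
  have h : BddAbove (⋃ k ∈ Set.Iic n, (fun z => ‖iteratedFDerivWithin ℝ k φ S z‖) '' S) := by
    refine (Set.finite_Iic n).bddAbove_biUnion.2 fun k hk => ?_
    exact (hc.image_of_continuousOn
      (hφ.continuousOn_iteratedFDerivWithin (by exact_mod_cast hk) hS).norm).bddAbove
  refine h.mono ?_
  rintro _ ⟨k, hk, z, hz, rfl⟩
  exact Set.mem_biUnion hk ⟨z, hz, rfl⟩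

theorem norm_iteratedFDerivWithin_le_ckNorm {d n : ℕ} {S : Set (Pt d)} (hc : IsCompact S)
    (hS : UniqueDiffOn ℝ S) {φ : Pt d → ℝ} (hφ : ContDiffOn ℝ (n : WithTop ℕ∞) φ S)
    {k : ℕ} (hk : k ≤ n) {z : Pt d} (hz : z ∈ S) :
    ‖iteratedFDerivWithin ℝ k φ S z‖ ≤ ckNorm n S φ :=
  le_csSup (bddAbove_ckNorm_set hc hS hφ) ⟨k, hk, z, hz, rfl⟩

theorem ckNorm_nonneg {d n : ℕ} {S : Set (Pt d)} {φ : Pt d → ℝ} : 0 ≤ ckNorm n S φ :=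
  Real.sSup_nonneg (by rintro _ ⟨k, _, z, _, rfl⟩; exact norm_nonneg _)

theorem abs_sub_taylorWithinSet_le_of_joined {d m : ℕ} {S : Set (Pt d)} (hc : IsCompact S)
    (hS : UniqueDiffOn ℝ S) {φ : Pt d → ℝ}
    (hφ : ContDiffOn ℝ ((m + 1 : ℕ) : WithTop ℕ∞) φ S) {γ : ℝ → Pt d} {L : ℝ} (hL : 0 ≤ L)
    (hγS : ∀ t ∈ Set.Icc (0 : ℝ) 1, γ t ∈ S)
    (hγ : ∀ s ∈ Set.Icc (0 : ℝ) 1, ∀ t ∈ Set.Icc (0 : ℝ) 1, dist (γ s) (γ t) ≤ L * |s - t|)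
    (h0 : γ 0 ∈ closure (interior S)) :
    |φ (γ 1) - taylorWithinSet m φ S (γ 0) (γ 1)| ≤ ckNorm (m + 1) S φ * L ^ (m + 1) := by
  set a := γ 0 with ha
  have haS : a ∈ S := hγS 0 (by simp)
  have hT : ∀ n : WithTop ℕ∞, ContDiff ℝ n (taylorWithinSet m φ S a) := fun n =>
    contDiff_taylorWithinSet m φ S a
  have hsub : ∀ k ≤ m + 1, ∀ z ∈ S,
      iteratedFDerivWithin ℝ k (fun z => φ z - taylorWithinSet m φ S a z) S z
        = iteratedFDerivWithin ℝ k φ S z - iteratedFDeriv ℝ k (taylorWithinSet m φ S a) z := by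
    intro k hk z hz
    have hk' : ((k : ℕ) : WithTop ℕ∞) ≤ ((m + 1 : ℕ) : WithTop ℕ∞) := by exact_mod_cast hk
    rw [← iteratedFDerivWithin_eq_iteratedFDeriv hS (hT k).contDiffAt hz]
    exact iteratedFDerivWithin_sub_apply ((hφ z hz).of_le hk')
      (hT k).contDiffWithinAt hS hz
  have := norm_le_of_iteratedFDerivWithin_eq_zero (n := m)
    (f := fun z => φ z - taylorWithinSet m φ S a z) (B := ckNorm (m + 1) S φ)
    (hφ.sub (hT _).contDiffOn) hS hL hγS hγ
    (fun z hz => by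
      rw [hsub _ le_rfl z hz, iteratedFDeriv_taylorWithinSet_of_lt (Nat.lt_succ_self m)]
      simpa using norm_iteratedFDerivWithin_le_ckNorm hc hS hφ le_rfl hz)
    (fun k hk => by
      rw [hsub k (by omega) _ haS, iteratedFDeriv_taylorWithinSet_center
        (hφ.of_le (by exact_mod_cast Nat.le_succ m)) hS haS h0 hk, sub_self])
  simpa using this

/-- Taylor's theorem with a remainder that is uniform over pairs of points of `Ω`. -/
theorem RegularityRegion.exists_taylor_bound {d : ℕ} (m : ℕ) {Ω S : Set (Pt d)}
    (h : RegularityRegion Ω S) (hΩc : IsCompact Ω) (hΩ : ∀ a ∈ Ω, a ∈ closure (interior Ω)) :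
    ∃ A : ℝ, 0 < A ∧ ∀ φ : Pt d → ℝ, ContDiffOn ℝ ((m + 1 : ℕ) : WithTop ℕ∞) φ S →
      ∀ a ∈ Ω, ∀ b ∈ Ω, |φ b - taylorWithinSet m φ S a b|
        ≤ A * ckNorm (m + 1) S φ * dist a b ^ (m + 1) := by
  obtain ⟨κ, ρ, hρ, hj⟩ := h.joined
  set D := Metric.diam Ω
  have hD : 0 ≤ D := Metric.diam_nonneg
  -- For pairs farther apart than `ρ` there may be no short curve. There `φ` and its Taylor
  -- polynomial are bounded separately, at a cost absorbed by `(dist a b / ρ)^(m+1) ≥ 1`.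
  set A₂ := 1 + ∑ k ∈ Finset.range (m + 1), D ^ k with hA₂
  have hA₂pos : 0 < A₂ := by positivity
  refine ⟨|κ| ^ (m + 1) + A₂ / ρ ^ (m + 1), by positivity, fun φ hφ a ha b hb => ?_⟩
  have hck : 0 ≤ ckNorm (m + 1) S φ := ckNorm_nonneg
  have hbound : ∀ k ≤ m + 1, ∀ z ∈ S, ‖iteratedFDerivWithin ℝ k φ S z‖ ≤ ckNorm (m + 1) S φ :=
    fun k hk z hz => norm_iteratedFDerivWithin_le_ckNorm h.compact h.uniqueDiff hφ hk hz
  rcases le_or_gt (dist a b) ρ with hle | hgt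
  · obtain ⟨γ, rfl, rfl, hγS, hγ⟩ := hj a ha b hb hle
    have := abs_sub_taylorWithinSet_le_of_joined h.compact h.uniqueDiff hφ
      (L := |κ| * dist (γ 0) (γ 1)) (by positivity) hγS
      (fun s hs t ht => (hγ s hs t ht).trans (by gcongr; exact le_abs_self κ))
      (closure_mono (interior_mono h.subset) (hΩ _ ha))
    refine this.trans ?_
    rw [mul_pow]
    have : 0 ≤ A₂ / ρ ^ (m + 1) * ckNorm (m + 1) S φ * dist (γ 0) (γ 1) ^ (m + 1) := by positivity
    linarith
  · have hdist : ‖b - a‖ ≤ D := by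
      rw [← dist_eq_norm]
      exact Metric.dist_le_diam_of_mem hΩc.isBounded hb ha
    have h1 : |φ b| ≤ ckNorm (m + 1) S φ := by
      have := hbound 0 (by omega) b (h.subset hb)
      rwa [norm_iteratedFDerivWithin_zero] at this
    have h2 : |taylorWithinSet m φ S a b|
        ≤ ∑ k ∈ Finset.range (m + 1), ckNorm (m + 1) S φ * D ^ k := by
      refine (Finset.abs_sum_le_sum_abs _ _).trans (Finset.sum_le_sum fun k hk => ?_)
      have hk' := Finset.mem_range.1 hk
      rw [smul_eq_mul, abs_mul, abs_of_nonneg (by positivity : (0 : ℝ) ≤ (k.factorial : ℝ)⁻¹)]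
      have hf : (k.factorial : ℝ)⁻¹ ≤ 1 :=
        inv_le_one_of_one_le₀ (by exact_mod_cast Nat.one_le_iff_ne_zero.2 k.factorial_ne_zero)
      have hop := (iteratedFDerivWithin ℝ k φ S a).le_opNorm (fun _ => b - a)
      rw [Finset.prod_const, Finset.card_univ, Fintype.card_fin, Real.norm_eq_abs] at hop
      calc _ ≤ 1 * |iteratedFDerivWithin ℝ k φ S a fun _ => b - a| := by gcongr
        _ ≤ ‖iteratedFDerivWithin ℝ k φ S a‖ * ‖b - a‖ ^ k := by rw [one_mul]; exact hop
        _ ≤ _ := by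
          gcongr
          exact hbound k (by omega) a (h.subset ha)
    have h3 : |φ b - taylorWithinSet m φ S a b| ≤ A₂ * ckNorm (m + 1) S φ := by
      refine (abs_sub _ _).trans ((add_le_add h1 h2).trans (le_of_eq ?_))
      rw [← Finset.mul_sum, hA₂]
      ring
    have h4 : 1 ≤ dist a b ^ (m + 1) / ρ ^ (m + 1) := by
      rw [one_le_div (by positivity)]
      gcongr
    calc _ ≤ A₂ * ckNorm (m + 1) S φ * 1 := by rw [mul_one]; exact h3
      _ ≤ A₂ * ckNorm (m + 1) S φ * (dist a b ^ (m + 1) / ρ ^ (m + 1)) := by gcongr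
      _ = A₂ / ρ ^ (m + 1) * ckNorm (m + 1) S φ * dist a b ^ (m + 1) := by ring
      _ ≤ _ := by
        gcongr
        exact le_add_of_nonneg_left (by positivity)

/-! ### The Taylor polynomial read at midpoints -/

/-- The polynomial `z ↦ g (2 (z - a), …, 2 (z - a))`. -/
def diagPoly {d k : ℕ} (g : ContinuousMultilinearMap ℝ (fun _ : Fin k => Pt d) ℝ) (a : Pt d) :
    MvPolynomial (Fin d) ℝ :=
  ∑ s : Fin k → Fin d, MvPolynomial.C (g fun i => EuclideanSpace.single (s i) (1 : ℝ)) *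
    ∏ i, (MvPolynomial.C 2 * (MvPolynomial.X (s i) - MvPolynomial.C (a (s i))))

theorem polyEval_diagPoly {d k : ℕ} (g : ContinuousMultilinearMap ℝ (fun _ : Fin k => Pt d) ℝ)
    (a z : Pt d) : polyEval z (diagPoly g a) = g (fun _ => (2 : ℝ) • (z - a)) := by
  have hv : (2 : ℝ) • (z - a)
      = ∑ l, (2 * (z l - a l)) • EuclideanSpace.single l (1 : ℝ) := by
    ext l
    simp [Pi.single_apply]
  have h1 : g (fun _ => (2 : ℝ) • (z - a))
      = g (fun _ : Fin k => ∑ l, (2 * (z l - a l)) • EuclideanSpace.single l (1 : ℝ)) := by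
    rw [← hv]
  rw [h1, g.map_sum]
  simp only [polyEval, diagPoly, map_sum, map_mul, map_prod, map_sub, MvPolynomial.eval_C,
    MvPolynomial.eval_X]
  refine Finset.sum_congr rfl fun s _ => ?_
  rw [g.map_smul_univ (fun i => 2 * (z (s i) - a (s i)))
    (fun i => EuclideanSpace.single (s i) (1 : ℝ)), smul_eq_mul, mul_comm]

theorem totalDegree_diagPoly_le {d k : ℕ}
    (g : ContinuousMultilinearMap ℝ (fun _ : Fin k => Pt d) ℝ) (a : Pt d) :
    (diagPoly g a).totalDegree ≤ k := by
  refine MvPolynomial.totalDegree_finsetSum_le fun s _ => ?_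
  refine (MvPolynomial.totalDegree_mul _ _).trans ?_
  rw [MvPolynomial.totalDegree_C, zero_add]
  refine (MvPolynomial.totalDegree_finsetProd _ _).trans ?_
  refine (Finset.sum_le_sum (g := fun _ => 1) fun i _ => ?_).trans (by simp)
  refine (MvPolynomial.totalDegree_mul _ _).trans ?_
  rw [MvPolynomial.totalDegree_C, zero_add]
  exact (MvPolynomial.totalDegree_sub_C_le _ _).trans (MvPolynomial.totalDegree_X _).le

/-- The polynomial that takes at the midpoint of `a` and `z` the value at `z` of the Taylor
polynomial at `a`, less its value at `a`. -/
def midTaylor {d : ℕ} (m : ℕ) (φ : Pt d → ℝ) (S : Set (Pt d)) (a : Pt d) :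
    MvPolynomial (Fin d) ℝ :=
  (∑ k ∈ Finset.range (m + 1), MvPolynomial.C (k.factorial : ℝ)⁻¹ *
    diagPoly (iteratedFDerivWithin ℝ k φ S a) a) - MvPolynomial.C (φ a)

/-- The value of a polynomial at the midpoint of `a` and `z`. -/
def midEval {d : ℕ} (a : Pt d) (p : MvPolynomial (Fin d) ℝ) (z : Pt d) : ℝ :=
  polyEval ((1 / 2 : ℝ) • (a + z)) p

theorem midEval_self {d : ℕ} (a : Pt d) (p : MvPolynomial (Fin d) ℝ) :
    midEval a p a = polyEval a p := by
  rw [midEval, ← two_smul ℝ a, smul_smul]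
  norm_num

theorem midEval_midTaylor {d : ℕ} (m : ℕ) (φ : Pt d → ℝ) (S : Set (Pt d)) (a z : Pt d) :
    midEval a (midTaylor m φ S a) z = taylorWithinSet m φ S a z - φ a := by
  have hz : (2 : ℝ) • ((1 / 2 : ℝ) • (a + z) - a) = z - a := by module
  rw [midEval, midTaylor, polyEval_sub, taylorWithinSet]
  congr 1
  · rw [polyEval, map_sum]
    refine Finset.sum_congr rfl fun k _ => ?_
    have := polyEval_diagPoly (iteratedFDerivWithin ℝ k φ S a) a ((1 / 2 : ℝ) • (a + z))
    rw [hz] at this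
    rw [map_mul, MvPolynomial.eval_C, ← this]
    rfl
  · simp [polyEval]

theorem taylorWithinSet_self {d m : ℕ} {φ : Pt d → ℝ} {S : Set (Pt d)} {a : Pt d} :
    taylorWithinSet m φ S a a = φ a := by
  rw [taylorWithinSet, Finset.sum_eq_single 0]
  · simp
  · intro k _ hk
    rw [sub_self, (iteratedFDerivWithin ℝ k φ S a).map_coord_zero ⟨0, Nat.pos_of_ne_zero hk⟩ rfl,
      smul_zero]
  · simp

theorem midTaylor_mem_vanishingPoly {d : ℕ} (m : ℕ) (φ : Pt d → ℝ) (S : Set (Pt d)) (a : Pt d) :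
    midTaylor m φ S a ∈ vanishingPoly m a := by
  constructor
  · refine (MvPolynomial.totalDegree_sub_C_le _ _).trans ?_
    refine MvPolynomial.totalDegree_finsetSum_le fun k hk => ?_
    refine (MvPolynomial.totalDegree_mul _ _).trans ?_
    rw [MvPolynomial.totalDegree_C, zero_add]
    exact (totalDegree_diagPoly_le _ _).trans (Nat.lt_succ_iff.1 (Finset.mem_range.1 hk))
  · rw [← midEval_self, midEval_midTaylor, taylorWithinSet_self, sub_self]

theorem hasFDerivAt_polyEval {d : ℕ} (p : MvPolynomial (Fin d) ℝ) (z : Pt d) :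
    HasFDerivAt (fun z : Pt d => polyEval z p)
      (∑ k, polyEval z (MvPolynomial.pderiv k p) • (EuclideanSpace.proj k : Pt d →L[ℝ] ℝ)) z := by
  induction p using MvPolynomial.induction_on with
  | C a => simpa [polyEval] using hasFDerivAt_const a z
  | add p q hp hq =>
    refine (hp.add hq).congr_fderiv ?_ |>.congr_of_eventuallyEq (.of_forall fun w => ?_)
    · rw [← Finset.sum_add_distrib]
      simp [polyEval, add_smul]
    · simp [polyEval]
  | mul_X p k hp =>
    have hX : HasFDerivAt (fun z : Pt d => z k) (EuclideanSpace.proj k : Pt d →L[ℝ] ℝ) z :=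
      (EuclideanSpace.proj k : Pt d →L[ℝ] ℝ).hasFDerivAt
    refine (hp.mul hX).congr_fderiv ?_ |>.congr_of_eventuallyEq (.of_forall fun w => ?_)
    · ext v
      simp only [polyEval, Derivation.leibniz, MvPolynomial.pderiv_X]
      simp [Pi.single_apply, add_mul, Finset.sum_add_distrib, Finset.mul_sum, apply_ite]
      ring_nf
    · simp [polyEval]

theorem fderiv_midEval_apply_single {d : ℕ} (a : Pt d) (p : MvPolynomial (Fin d) ℝ) (z : Pt d)
    (k : Fin d) : fderiv ℝ (midEval a p) z (EuclideanSpace.single k (1 : ℝ))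
      = (1 / 2) * midEval a (MvPolynomial.pderiv k p) z := by
  have h1 : HasFDerivAt (fun z : Pt d => (1 / 2 : ℝ) • (a + z))
      ((1 / 2 : ℝ) • ContinuousLinearMap.id ℝ (Pt d)) z :=
    ((hasFDerivAt_id z).const_add a).const_smul (1 / 2 : ℝ)
  have h2 := (hasFDerivAt_polyEval p ((1 / 2 : ℝ) • (a + z))).comp z h1
  have h3 : midEval a p = (fun z : Pt d => polyEval z p) ∘ fun z : Pt d => (1 / 2 : ℝ) • (a + z) :=
    rfl
  rw [h3, h2.fderiv]
  simp [midEval, mul_comm]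

theorem contDiff_midEval {d : ℕ} (a : Pt d) (p : MvPolynomial (Fin d) ℝ) {n : WithTop ℕ∞} :
    ContDiff ℝ n (midEval a p) := by
  induction p using MvPolynomial.induction_on with
  | C c =>
    have : midEval a (MvPolynomial.C c) = fun _ => c := by
      funext z; simp [midEval, polyEval]
    rw [this]
    exact contDiff_const
  | add p q hp hq =>
    have : midEval a (p + q) = fun z => midEval a p z + midEval a q z := by
      funext z; simp [midEval, polyEval]
    rw [this]
    exact hp.add hq
  | mul_X p k hp =>
    have : midEval a (p * MvPolynomial.X k) = fun z => midEval a p z * (1 / 2 * (a k + z k)) := by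
      funext z; simp [midEval, polyEval, mul_add]
    rw [this]
    refine hp.mul ?_
    fun_prop

theorem iteratedFDeriv_two_midEval {d : ℕ} (a : Pt d) (p : MvPolynomial (Fin d) ℝ) (z : Pt d)
    (k : Fin d) :
    iteratedFDeriv ℝ 2 (midEval a p) z
        ![EuclideanSpace.single k (1 : ℝ), EuclideanSpace.single k (1 : ℝ)]
      = (1 / 4) * midEval a (MvPolynomial.pderiv k (MvPolynomial.pderiv k p)) z := by
  rw [iteratedFDeriv_two_apply]
  have hd : DifferentiableAt ℝ (fderiv ℝ (midEval a p)) z :=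
    ((contDiff_midEval a p (n := 2)).fderiv_right (m := 1) (by norm_num)).differentiable
      (by simp) z
  have h1 : fderiv ℝ (fun w => fderiv ℝ (midEval a p) w (EuclideanSpace.single k (1 : ℝ))) z
      (EuclideanSpace.single k (1 : ℝ)) = fderiv ℝ (fderiv ℝ (midEval a p)) z
        (EuclideanSpace.single k (1 : ℝ)) (EuclideanSpace.single k (1 : ℝ)) := by
    rw [fderiv_clm_apply hd (differentiableAt_const _)]
    simp
  simp only [Matrix.cons_val_zero, Matrix.cons_val_one]
  rw [← h1]
  simp only [fderiv_midEval_apply_single]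
  have h2 := fderiv_const_mul (𝕜 := ℝ)
    ((contDiff_midEval a (MvPolynomial.pderiv k p) (n := 1)).differentiable (by simp) z)
    (1 / 2 : ℝ)
  rw [h2]
  simp only [_root_.smul_apply, fderiv_midEval_apply_single, smul_eq_mul]
  ring

theorem taylorWithinSet_eq_add_midEval {d : ℕ} (m : ℕ) (φ : Pt d → ℝ) (S : Set (Pt d))
    (a : Pt d) :
    taylorWithinSet m φ S a = fun z => φ a + midEval a (midTaylor m φ S a) z := by
  funext z
  rw [midEval_midTaylor]
  ring

/-- The Taylor polynomial has the gradient of `φ` at `a`, and the midpoint map contributes one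
factor 1/2 by the chain rule; second derivatives acquire 1/4 in the same way. -/
theorem gradientWithin_eq_polyGrad_midTaylor {d m : ℕ} (hm : 0 < m) {φ : Pt d → ℝ}
    {S : Set (Pt d)} {a : Pt d} (hφ : ContDiffOn ℝ (m : WithTop ℕ∞) φ S)
    (hS : UniqueDiffOn ℝ S) (ha : a ∈ S) (ha' : a ∈ closure (interior S)) :
    gradientWithin φ S a = (1 / 2 : ℝ) • polyGrad a (midTaylor m φ S a) := by
  have h1 := iteratedFDeriv_taylorWithinSet_center hφ hS ha ha' (k := 1) hm
  ext k
  have h2 : gradientWithin φ S a k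
      = fderivWithin ℝ φ S a (EuclideanSpace.single k (1 : ℝ)) := by
    have := InnerProductSpace.toDual_symm_apply (𝕜 := ℝ) (x := EuclideanSpace.single k (1 : ℝ))
      (y := fderivWithin ℝ φ S a)
    rw [← this, EuclideanSpace.inner_single_right]
    simp [gradientWithin]
  have h3 := congrArg (fun g => g (fun _ => EuclideanSpace.single k (1 : ℝ))) h1
  simp only [iteratedFDeriv_one_apply,
    iteratedFDerivWithin_one_apply (hS a ha)] at h3
  rw [h2, ← h3, taylorWithinSet_eq_add_midEval, fderiv_const_add, fderiv_midEval_apply_single,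
    midEval_self]
  simp [polyGrad]

theorem sum_iteratedFDeriv_two_taylorWithinSet {d : ℕ} (m : ℕ) (φ : Pt d → ℝ) (S : Set (Pt d))
    (a : Pt d) :
    ∑ k : Fin d, iteratedFDeriv ℝ 2 (taylorWithinSet m φ S a) a
        ![EuclideanSpace.single k (1 : ℝ), EuclideanSpace.single k (1 : ℝ)]
      = (1 / 4) * polyLaplacian a (midTaylor m φ S a) := by
  rw [polyLaplacian, Finset.mul_sum]
  refine Finset.sum_congr rfl fun k _ => ?_
  rw [← midEval_self, ← iteratedFDeriv_two_midEval, taylorWithinSet_eq_add_midEval]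
  rw [iteratedFDeriv_two_apply, iteratedFDeriv_two_apply]
  have : fderiv ℝ (fun z => φ a + midEval a (midTaylor m φ S a) z)
      = fderiv ℝ (midEval a (midTaylor m φ S a)) := by
    funext z
    rw [fderiv_const_add]
  rw [this]

theorem laplacianWithin_eq_sum_single {d : ℕ} {φ : Pt d → ℝ} {S : Set (Pt d)} {a : Pt d}
    (hS : UniqueDiffOn ℝ S) (ha : a ∈ S) :
    InnerProductSpace.laplacianWithin φ S a = ∑ k : Fin d, iteratedFDerivWithin ℝ 2 φ S a
      ![EuclideanSpace.single k (1 : ℝ), EuclideanSpace.single k (1 : ℝ)] := by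
  rw [InnerProductSpace.laplacianWithin_eq_iteratedFDerivWithin_orthonormalBasis φ hS ha
    (EuclideanSpace.basisFun (Fin d) ℝ)]
  simp

/-- For `m ≥ 2` the two Laplacians coincide. For `m = 1` the Taylor polynomial is affine, and since
`h^0 = 1` it suffices to bound the second derivatives of `φ` by the norm. -/
theorem abs_laplacianWithin_sub_midTaylor_le {d m : ℕ} (hm : 0 < m) {φ : Pt d → ℝ}
    {S : Set (Pt d)} {a : Pt d} (hc : IsCompact S)
    (hφ : ContDiffOn ℝ ((m + 1 : ℕ) : WithTop ℕ∞) φ S)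
    (hS : UniqueDiffOn ℝ S) (ha : a ∈ S) (ha' : a ∈ closure (interior S)) {h : ℝ} (hh : 0 < h) :
    |InnerProductSpace.laplacianWithin φ S a - (1 / 4) * polyLaplacian a (midTaylor m φ S a)|
      ≤ d * h ^ (m - 1) * ckNorm (m + 1) S φ := by
  have hck : 0 ≤ ckNorm (m + 1) S φ := ckNorm_nonneg
  rw [← sum_iteratedFDeriv_two_taylorWithinSet, laplacianWithin_eq_sum_single hS ha]
  rcases Nat.lt_or_ge 1 m with h1 | h1
  · rw [iteratedFDeriv_taylorWithinSet_center (hφ.of_le (by exact_mod_cast Nat.le_succ m))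
      hS ha ha' h1, sub_self, abs_zero]
    positivity
  · obtain rfl : m = 1 := by omega
    rw [iteratedFDeriv_taylorWithinSet_of_lt (by norm_num)]
    simp only [Pi.zero_apply, _root_.zero_apply, Finset.sum_const_zero, sub_zero]
    refine (Finset.abs_sum_le_sum_abs _ _).trans ?_
    refine (Finset.sum_le_sum (g := fun _ => ckNorm (1 + 1) S φ) fun k _ => ?_).trans (by simp)
    refine ((iteratedFDerivWithin ℝ 2 φ S a).le_opNorm _).trans ?_
    simpa [Fin.prod_univ_two] using norm_iteratedFDerivWithin_le_ckNorm hc hS hφ le_rfl ha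

/-! ### Existence and comparison of least-squares fits -/

section LeastSquares

variable {d N m : ℕ} {Φ : ℝ → ℝ} {x : Fin N → Pt d} {ε : ℝ} {i : Fin N}

theorem sub_mem_vanishingPoly {a : Pt d} {p q : MvPolynomial (Fin d) ℝ}
    (hp : p ∈ vanishingPoly m a) (hq : q ∈ vanishingPoly m a) : p - q ∈ vanishingPoly m a :=
  ⟨(MvPolynomial.totalDegree_sub _ _).trans (max_le hp.1 hq.1), by
    rw [polyEval_sub, hp.2, hq.2, sub_zero]⟩

/-- The polynomials of degree at most `m` that vanish at `a`, as a subspace. -/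
def vanishingSubmodule (m : ℕ) (a : Pt d) : Submodule ℝ (MvPolynomial (Fin d) ℝ) where
  carrier := vanishingPoly m a
  add_mem' {p q} hp hq := ⟨(MvPolynomial.totalDegree_add _ _).trans (max_le hp.1 hq.1), by
    have h1 := hp.2
    have h2 := hq.2
    simp_all [polyEval]⟩
  zero_mem' := ⟨by simp, by simp [polyEval]⟩
  smul_mem' t p hp := ⟨(MvPolynomial.totalDegree_smul_le _ _).trans hp.1, by
    have h1 := hp.2
    simp_all [polyEval]⟩

/-- After scaling by the square roots of the weights, a fit is a nearest point in the image of the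
polynomial space. That image is a subspace of a finite-dimensional space, hence closed. -/
theorem exists_isFit (hw : ∀ j : Nbr x ε i, 0 ≤ Φ ‖x i - edgeMid x i j‖)
    (u : EdgeSpace x ε i) : ∃ p, IsFit m Φ x ε i u p := by
  let A : MvPolynomial (Fin d) ℝ →ₗ[ℝ] EuclideanSpace ℝ (Nbr x ε i) :=
    { toFun := fun p => WithLp.toLp 2 fun j =>
        √(Φ ‖x i - edgeMid x i j‖) * polyEval (edgeMid x i j) p
      map_add' := fun p q => by ext j; simp [polyEval, mul_add]
      map_smul' := fun t p => by ext j; simp [polyEval, mul_left_comm] }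
  let b : EuclideanSpace ℝ (Nbr x ε i) := WithLp.toLp 2 fun j =>
    √(Φ ‖x i - edgeMid x i j‖) * u j
  have hA : ∀ p, lsqFunctional Φ x ε i u p = dist b (A p) ^ 2 := by
    intro p
    rw [dist_eq_norm, EuclideanSpace.norm_sq_eq, lsqFunctional]
    refine Finset.sum_congr rfl fun j _ => ?_
    have : (b - A p) j = √(Φ ‖x i - edgeMid x i j‖) * (u j - polyEval (edgeMid x i j) p) := by
      simp [A, b, mul_sub]
    rw [this, Real.norm_eq_abs, sq_abs, mul_pow, Real.sq_sqrt (hw j), mul_comm]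
  obtain ⟨_, ⟨p, hp, rfl⟩, hmin⟩ :=
    ((vanishingSubmodule m (x i)).map A).closed_of_finiteDimensional.exists_infDist_eq_dist
      ⟨0, Submodule.zero_mem _⟩ b
  refine ⟨p, hp, fun q hq => ?_⟩
  simp only [Set.mem_ofPred_eq, hA]
  have : dist b (A p) ≤ dist b (A q) := by
    rw [← hmin]
    exact Metric.infDist_le_dist_of_mem ⟨q, hq, rfl⟩
  gcongr

theorem isFit_gmlsFit (hw : ∀ j : Nbr x ε i, 0 ≤ Φ ‖x i - edgeMid x i j‖)
    (u : EdgeSpace x ε i) : IsFit m Φ x ε i u (gmlsFit m Φ x ε i u) := by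
  have h := exists_isFit (m := m) hw u
  rw [gmlsFit, dif_pos h]
  exact h.choose_spec

theorem IsFit.sum_sq_sub_le (hw : ∀ j : Nbr x ε i, 0 ≤ Φ ‖x i - edgeMid x i j‖)
    {u : EdgeSpace x ε i} {p q : MvPolynomial (Fin d) ℝ} (hp : IsFit m Φ x ε i u p)
    (hq : q ∈ vanishingPoly m (x i)) :
    ∑ j : Nbr x ε i, polyEval (edgeMid x i j) (p - q) ^ 2 * Φ ‖x i - edgeMid x i j‖
      ≤ 4 * lsqFunctional Φ x ε i u q := by
  have h1 : lsqFunctional Φ x ε i u p ≤ lsqFunctional Φ x ε i u q := hp.2 hq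
  suffices h2 : ∑ j : Nbr x ε i, polyEval (edgeMid x i j) (p - q) ^ 2 * Φ ‖x i - edgeMid x i j‖
      ≤ 2 * lsqFunctional Φ x ε i u p + 2 * lsqFunctional Φ x ε i u q by linarith
  rw [lsqFunctional, lsqFunctional, Finset.mul_sum, Finset.mul_sum, ← Finset.sum_add_distrib]
  refine Finset.sum_le_sum fun j _ => ?_
  rw [← mul_assoc, ← mul_assoc, ← add_mul, polyEval_sub]
  refine mul_le_mul_of_nonneg_right ?_ (hw j)
  nlinarith [sq_nonneg (u j - polyEval (edgeMid x i j) p + (u j - polyEval (edgeMid x i j) q))]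

/-- Two least-squares fits agree at all edges, up to the weights. -/
theorem IsFit.sum_sq_sub_eq_zero {u : EdgeSpace x ε i} {p q : MvPolynomial (Fin d) ℝ}
    (hp : IsFit m Φ x ε i u p) (hq : IsFit m Φ x ε i u q) :
    ∑ j : Nbr x ε i, polyEval (edgeMid x i j) (p - q) ^ 2 * Φ ‖x i - edgeMid x i j‖ ≤ 0 := by
  -- The parallelogram identity: if two minimizers differed at an edge of positive weight, their
  -- mean would do strictly better.
  have hmem : (1 / 2 : ℝ) • (p + q) ∈ vanishingPoly m (x i) :=
    (vanishingSubmodule m (x i)).smul_mem _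
      ((vanishingSubmodule m (x i)).add_mem hp.1 hq.1)
  have h1 : lsqFunctional Φ x ε i u p ≤ lsqFunctional Φ x ε i u ((1 / 2 : ℝ) • (p + q)) :=
    hp.2 hmem
  have h2 : lsqFunctional Φ x ε i u q ≤ lsqFunctional Φ x ε i u ((1 / 2 : ℝ) • (p + q)) :=
    hq.2 hmem
  have h3 : ∑ j : Nbr x ε i, polyEval (edgeMid x i j) (p - q) ^ 2 * Φ ‖x i - edgeMid x i j‖
      = 2 * lsqFunctional Φ x ε i u p + 2 * lsqFunctional Φ x ε i u q
        - 4 * lsqFunctional Φ x ε i u ((1 / 2 : ℝ) • (p + q)) := by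
    simp only [lsqFunctional, Finset.mul_sum, ← Finset.sum_add_distrib,
      ← Finset.sum_sub_distrib]
    refine Finset.sum_congr rfl fun j _ => ?_
    have : polyEval (edgeMid x i j) ((1 / 2 : ℝ) • (p + q))
        = 1 / 2 * (polyEval (edgeMid x i j) p + polyEval (edgeMid x i j) q) := by
      simp [polyEval, mul_add]
    rw [this, polyEval_sub]
    ring
  linarith

end LeastSquares

/-! ### Packing and bounds on the weight -/

/-- The number of `t`-separated points in a ball of radius `B t` is bounded. -/
theorem exists_card_le_of_separated (d : ℕ) (B : ℝ) :
    ∃ n : ℕ, ∀ (ι : Type) (s : Finset ι) (y : ι → Pt d) (a : Pt d) (t : ℝ), 0 < t →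
      (∀ j ∈ s, dist (y j) a ≤ B * t) →
      (∀ j ∈ s, ∀ k ∈ s, j ≠ k → t ≤ dist (y j) (y k)) → s.card ≤ n := by
  -- After rescaling to separation 1, an open ball of radius 1/2 holds at most one of the points, so
  -- a finite cover counts them.
  obtain ⟨T, hT, hcover⟩ := Metric.totallyBounded_iff.1
    (isCompact_closedBall (0 : Pt d) B).totallyBounded (1 / 2) (by norm_num)
  refine ⟨hT.toFinset.card, fun ι s y a t ht hB hsep => ?_⟩
  have hmem : ∀ j ∈ s, ∃ c ∈ T, dist (t⁻¹ • (y j - a)) c < 1 / 2 := by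
    intro j hj
    have : t⁻¹ • (y j - a) ∈ Metric.closedBall (0 : Pt d) B := by
      rw [mem_closedBall_zero_iff, norm_smul, norm_inv, Real.norm_of_nonneg ht.le,
        inv_mul_le_iff₀ ht, ← dist_eq_norm, mul_comm]
      exact hB j hj
    simpa using hcover this
  choose! f hf using hmem
  refine Finset.card_le_card_of_injOn f (fun j hj => by simpa using (hf j hj).1) ?_
  intro j hj k hk hjk
  by_contra hne
  have h1 := (hf j hj).2
  have h2 := (hf k hk).2
  rw [← hjk] at h2
  have h3 := dist_triangle_right (t⁻¹ • (y j - a)) (t⁻¹ • (y k - a)) (f j)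
  rw [dist_eq_norm, ← smul_sub, sub_sub_sub_cancel_right, norm_smul, norm_inv,
    Real.norm_of_nonneg ht.le, ← dist_eq_norm] at h3
  have h4 : 1 ≤ t⁻¹ * dist (y j) (y k) := by
    rw [inv_mul_eq_div, one_le_div ht]
    exact hsep j hj k hk hne
  linarith

theorem WeightCondition.profile {Φ ψ : ℝ → ℝ} {δ : ℝ} (hδ : 0 < δ) (hΦ : WeightCondition Φ δ)
    (h : ∀ s, 0 ≤ s → Φ s = ψ (s / δ)) : WeightCondition ψ 1 := by
  have hψ : ∀ t, 0 ≤ t → ψ t = Φ (δ * t) := by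
    intro t ht
    rw [h _ (by positivity), mul_div_cancel_left₀ _ hδ.ne']
  refine ⟨?_, fun s hs => ?_, fun s hs => ?_, fun s hs hs' => ?_⟩
  · refine (hΦ.cont.comp (f := fun t => δ * t) (by fun_prop) fun t ht => ?_).congr fun t ht =>
      hψ t ht
    exact mul_nonneg hδ.le ht
  · rw [hψ s hs]
    exact hΦ.nonneg _ (by positivity)
  · rw [hψ s (by linarith)]
    exact hΦ.support _ (by nlinarith)
  · rw [hψ s hs]
    exact hΦ.pos _ (by positivity) (by nlinarith)

/-- The threshold 1/4 suffices because nodes within `C(θ)h = δ/2` of `x_i` have their midpoints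
within `δ/4`, strictly inside the region of positivity. -/
theorem WeightCondition.exists_bounds {ψ : ℝ → ℝ} (h : WeightCondition ψ 1) :
    ∃ w W : ℝ, 0 < w ∧ 0 < W ∧ (∀ t, 0 ≤ t → t ≤ 1 / 4 → w ≤ ψ t) ∧ ∀ t, 0 ≤ t → ψ t ≤ W := by
  obtain ⟨t₀, ht₀, hmin⟩ := (isCompact_Icc (a := (0 : ℝ)) (b := 1 / 4)).exists_isMinOn
    ⟨0, by norm_num⟩ (h.cont.mono fun t ht => ht.1)
  obtain ⟨t₁, ht₁, hmax⟩ := (isCompact_Icc (a := (0 : ℝ)) (b := 1)).exists_isMaxOn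
    ⟨0, by norm_num⟩ (h.cont.mono fun t ht => ht.1)
  have h0 : 0 < ψ t₁ := (h.pos 0 le_rfl (by norm_num)).trans_le (hmax (by norm_num))
  refine ⟨ψ t₀, ψ t₁, h.pos _ ht₀.1 (by linarith [ht₀.2]), h0,
    fun t h1 h2 => hmin ⟨h1, h2⟩, fun t h1 => ?_⟩
  rcases le_or_gt t 1 with h2 | h2
  · exact hmax ⟨h1, h2⟩
  · rw [h.support t h2]
    exact h0.le

theorem norm_sub_edgeMid {d N : ℕ} (x : Fin N → Pt d) (i j : Fin N) :
    ‖x i - edgeMid x i j‖ = ‖x j - x i‖ / 2 := by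
  have : x i - edgeMid x i j = (-(1 / 2) : ℝ) • (x j - x i) := by
    rw [edgeMid]
    module
  rw [this, norm_smul]
  norm_num
  ring

theorem norm_le_card_mul {d : ℕ} {v : Pt d} {M : ℝ} (hM : ∀ k, |v k| ≤ M) : ‖v‖ ≤ d * M := by
  have hv : v = ∑ k, v k • EuclideanSpace.single k (1 : ℝ) := by
    ext l
    simp [Pi.single_apply]
  rw [hv]
  refine (norm_sum_le _ _).trans ((Finset.sum_le_sum (g := fun _ => M) fun k _ => ?_).trans ?_)
  · simpa [norm_smul] using hM k
  · simp

theorem polyGrad_sub {d : ℕ} (a : Pt d) (p q : MvPolynomial (Fin d) ℝ) :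
    polyGrad a (p - q) = polyGrad a p - polyGrad a q := by
  ext k
  simp [polyGrad, polyEval]

theorem polyLaplacian_sub {d : ℕ} (a : Pt d) (p q : MvPolynomial (Fin d) ℝ) :
    polyLaplacian a (p - q) = polyLaplacian a p - polyLaplacian a q := by
  simp [polyLaplacian, polyEval, Finset.sum_sub_distrib]

/-! ### Consistency and stability -/

/-- The least-squares residual of the Taylor polynomial. -/
theorem exists_lsqFunctional_midTaylor_le {d m : ℕ} (hm : 0 < m) {Ω S : Set (Pt d)} {r θ : ℝ}
    (hΩ : DomainCondition Ω r θ) (hS : RegularityRegion Ω S) (c W : ℝ) (hW : 0 < W) :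
    ∃ A : ℝ, 0 < A ∧ ∀ (N : ℕ) (x : Fin N → Pt d), NodeCondition Ω r θ m c x →
      ∀ Φ : ℝ → ℝ, WeightCondition Φ (2 * coneConst m θ * fillDistance x Ω) →
      (∀ s, 0 ≤ s → Φ s ≤ W) →
      ∀ (i : Fin N) (ε : ℝ) (hε : 0 < ε),
      ∀ φ : Pt d → ℝ, ContDiffOn ℝ ((m + 1 : ℕ) : WithTop ℕ∞) φ S →
        lsqFunctional Φ x ε i
            (topGrad x hε i (restrictNodal x ε i (fun j => φ (x j)))) (midTaylor m φ S (x i))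
          ≤ (A * ckNorm (m + 1) S φ * fillDistance x Ω ^ (m + 1)) ^ 2 := by
  classical
  obtain ⟨A, hA, htaylor⟩ := hS.exists_taylor_bound m hΩ.compact
    (fun a ha => hΩ.mem_closure_interior ha)
  -- Edges with nonzero weight have length at most `2δ = 4C(θ)h`, and distinct nodes are at least
  -- `2q_X ≥ 2h/c` apart; the quotient of these lengths is `2C(θ)c`.
  obtain ⟨n, hn⟩ := exists_card_le_of_separated d (2 * coneConst m θ * c)
  have hC := hΩ.coneConst_pos hm
  refine ⟨√((n + 1) * W) * (A * (4 * coneConst m θ) ^ (m + 1)), by positivity,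
    fun N x hx Φ hΦ hΦW i ε hε φ hφ => ?_⟩
  set h := fillDistance x Ω with hh
  have hpos : 0 < h := hx.fillDistance_pos hΩ i
  have hc : 0 < c := hx.const_pos hΩ i
  have hck : 0 ≤ ckNorm (m + 1) S φ := ckNorm_nonneg
  set η := A * ckNorm (m + 1) S φ * (4 * coneConst m θ * h) ^ (m + 1) with hη
  have hη0 : 0 ≤ η := by positivity
  set s : Finset (Nbr x ε i) := Finset.univ.filter
    fun j => ‖x i - edgeMid x i j‖ ≤ 2 * coneConst m θ * h with hs
  have hdist : ∀ j ∈ s, dist (x j) (x i) ≤ 4 * coneConst m θ * h := by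
    intro j hj
    have := (Finset.mem_filter.1 hj).2
    rw [norm_sub_edgeMid] at this
    rw [dist_eq_norm]
    linarith
  have hcard : s.card ≤ n := by
    refine hn _ s (fun j => x j) (x i) (2 * h / c) (by positivity) (fun j hj => ?_)
      fun j _ k _ hjk => ?_
    · refine (hdist j hj).trans (le_of_eq ?_)
      field_simp
      ring
    · have h1 := two_mul_separationDistance_le x (fun e => hjk (Subtype.ext e))
      have h2 := hx.fill_le_sep
      rw [div_le_iff₀ hc]
      nlinarith
  have hsum : lsqFunctional Φ x ε i
      (topGrad x hε i (restrictNodal x ε i (fun j => φ (x j)))) (midTaylor m φ S (x i))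
        ≤ ∑ j ∈ s, η ^ 2 * W := by
    rw [lsqFunctional, ← Finset.sum_subset (Finset.subset_univ s)]
    · refine Finset.sum_le_sum fun j hj => ?_
      have h1 : polyEval (edgeMid x i j) (midTaylor m φ S (x i))
          = taylorWithinSet m φ S (x i) (x j) - φ (x i) := midEval_midTaylor m φ S (x i) (x j)
      have h2 : topGrad x hε i (restrictNodal x ε i (fun j => φ (x j))) j
          = φ (x j) - φ (x i) := rfl
      rw [h1, h2, sub_sub_sub_cancel_right]
      have h3 : |φ (x j) - taylorWithinSet m φ S (x i) (x j)| ≤ η := by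
        refine (htaylor φ hφ _ (hx.mem i) _ (hx.mem j)).trans ?_
        rw [dist_comm, hη]
        gcongr
        exact hdist j hj
      have h4 : (φ (x j) - taylorWithinSet m φ S (x i) (x j)) ^ 2 ≤ η ^ 2 := by
        rw [← sq_abs]
        gcongr
      exact mul_le_mul h4 (hΦW _ (norm_nonneg _)) (hΦ.nonneg _ (norm_nonneg _)) (sq_nonneg _)
    · intro j _ hj
      have : 2 * coneConst m θ * h < ‖x i - edgeMid x i j‖ := by
        by_contra hle
        exact hj (Finset.mem_filter.2 ⟨Finset.mem_univ _, not_lt.1 hle⟩)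
      rw [hΦ.support _ this, mul_zero]
  refine hsum.trans ?_
  rw [Finset.sum_const, nsmul_eq_mul]
  have h5 : (s.card : ℝ) ≤ n + 1 := by
    have : (s.card : ℝ) ≤ n := by exact_mod_cast hcard
    linarith
  have h6 : (√((n + 1) * W) * (A * (4 * coneConst m θ) ^ (m + 1)) * ckNorm (m + 1) S φ
      * h ^ (m + 1)) ^ 2 = ((n + 1) * W) * η ^ 2 := by
    rw [hη, mul_pow (4 * coneConst m θ) h]
    simp only [mul_pow]
    rw [Real.sq_sqrt (by positivity)]
    ring
  rw [h6]
  calc (s.card : ℝ) * (η ^ 2 * W) ≤ (n + 1) * (η ^ 2 * W) := by gcongr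
    _ = _ := by ring

/-- A polynomial whose weighted sum of squares over the edges is small has small derivatives. -/
theorem NodeCondition.derivative_bounds {d N m : ℕ} (hm : 0 < m) {Ω : Set (Pt d)} {r θ c : ℝ}
    {x : Fin N → Pt d} (hΩ : DomainCondition Ω r θ) (hx : NodeCondition Ω r θ m c x)
    {Φ : ℝ → ℝ} (hΦ : WeightCondition Φ (2 * coneConst m θ * fillDistance x Ω)) {w : ℝ}
    (hw : 0 < w) (hΦw : ∀ s, 0 ≤ s → s ≤ coneConst m θ * fillDistance x Ω / 2 → w ≤ Φ s)
    {i : Fin N} {ε : ℝ} (hε : 2 * coneConst m θ * fillDistance x Ω ≤ ε)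
    {p : MvPolynomial (Fin d) ℝ} (hp : p.totalDegree ≤ m) {B : ℝ} (hB : 0 ≤ B)
    (hsum : ∑ j : Nbr x ε i, polyEval (edgeMid x i j) p ^ 2 * Φ ‖x i - edgeMid x i j‖
      ≤ w * B ^ 2) :
    (∀ k, |polyEval (x i) (MvPolynomial.pderiv k p)| ≤ 2 * B / fillDistance x Ω) ∧
    (∀ k, |polyEval (x i) (MvPolynomial.pderiv k (MvPolynomial.pderiv k p))|
      ≤ 2 * B / fillDistance x Ω ^ 2) ∧ (B = 0 → p = 0) := by
  obtain ⟨K, b, σ, hK, hiK, hσ, hσh, hbK, hnorm⟩ := hx.exists_norming_cone hm hΩ i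
  have hpos : 0 < fillDistance x Ω := hx.fillDistance_pos hΩ i
  have hC := hΩ.coneConst_pos hm
  set h := fillDistance x Ω
  have hCh : 0 < coneConst m θ * h := by positivity
  -- Each edge used for norming has weight at least `w` and is one term of a nonnegative sum, so the
  -- value of `p` at its midpoint is at most `B`.
  have hval : ∀ z ∈ K, |polyEval z p| ≤ 2 * B := by
    refine hnorm p hp B fun j hj => ?_
    have hjε : ‖x j - x i‖ < ε := by linarith
    have h1 : polyEval (edgeMid x i j) p ^ 2 * Φ ‖x i - edgeMid x i j‖ ≤ w * B ^ 2 :=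
      (Finset.single_le_sum (f := fun j : Nbr x ε i =>
        polyEval (edgeMid x i j) p ^ 2 * Φ ‖x i - edgeMid x i j‖)
        (fun k _ => mul_nonneg (sq_nonneg _) (hΦ.nonneg _ (norm_nonneg _)))
        (Finset.mem_univ (⟨j, hjε⟩ : Nbr x ε i))).trans hsum
    have h2 : w ≤ Φ ‖x i - edgeMid x i j‖ := by
      refine hΦw _ (norm_nonneg _) ?_
      rw [norm_sub_edgeMid]
      linarith
    have h3 : polyEval (edgeMid x i j) p ^ 2 ≤ B ^ 2 := by
      refine le_of_mul_le_mul_left (le_trans ?_ h1) hw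
      rw [mul_comm]
      gcongr
    exact abs_le_of_sq_le_sq h3 hB
  have hder : ∀ k, ∀ z ∈ K, |polyEval z (MvPolynomial.pderiv k p)| ≤ 2 * B / h := by
    intro k z hz
    refine (abs_polyEval_pderiv_le hK hσ hbK hp hval hz k).trans ?_
    rw [div_eq_mul_one_div (2 * B), mul_comm (2 * B)]
    gcongr
  refine ⟨fun k => hder k _ hiK, fun k => ?_, fun hB0 => ?_⟩
  · refine (abs_polyEval_pderiv_le hK hσ hbK ((totalDegree_pderiv_le k p).trans hp)
      (hder k) hiK k).trans ?_
    have : 2 * B / h ^ 2 = 1 / h * (2 * B / h) := by field_simp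
    rw [this]
    gcongr
  · refine eq_zero_of_polyEval_eq_zero_on_ball (b := b) hσ fun z hz => ?_
    have := hval z (hbK hz)
    rw [hB0, mul_zero] at this
    exact abs_eq_zero.1 (le_antisymm this (abs_nonneg _))

end StaggeredGMLS

end

/-! ### The error estimates -/

theorem theorem5p1 {d m : ℕ} (hm : 0 < m)
    (Ω S : Set (StaggeredGMLS.Pt d)) (r θ : ℝ)
    (hΩ : StaggeredGMLS.DomainCondition Ω r θ)
    (hS : StaggeredGMLS.RegularityRegion Ω S)
    (c : ℝ) (ψ : ℝ → ℝ) :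
    ∃ C : ℝ, 0 < C ∧
      ∀ (N : ℕ) (x : Fin N → StaggeredGMLS.Pt d) (h δ : ℝ),
        StaggeredGMLS.NodeCondition Ω r θ m c x →
        h = StaggeredGMLS.fillDistance x Ω →
        δ = 2 * StaggeredGMLS.coneConst m θ * h →
      ∀ Φ : ℝ → ℝ, StaggeredGMLS.WeightCondition Φ δ →
        (∀ s, 0 ≤ s → Φ s = ψ (s / δ)) →
      ∀ (i : Fin N) (ε : ℝ) (hε : 0 < ε), δ ≤ ε →
      ∀ φ : StaggeredGMLS.Pt d → ℝ, ContDiffOn ℝ ((m + 1 : ℕ) : WithTop ℕ∞) φ S →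
      ∀ g : StaggeredGMLS.EdgeSpace x ε i,
        g = StaggeredGMLS.topGrad x hε i
              (StaggeredGMLS.restrictNodal x ε i (fun j => φ (x j))) →
        (∃! p, StaggeredGMLS.IsFit m Φ x ε i g p) ∧
        |InnerProductSpace.laplacianWithin φ S (x i) - StaggeredGMLS.gmlsDiv m Φ x ε i g|
          ≤ C * h ^ (m - 1) * StaggeredGMLS.ckNorm (m + 1) S φ ∧
        ‖gradientWithin φ S (x i) - StaggeredGMLS.gmlsField m Φ x ε i g‖
          ≤ C * h ^ m * StaggeredGMLS.ckNorm (m + 1) S φ := by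
  open StaggeredGMLS in
  have hC := hΩ.coneConst_pos hm
  -- If `ψ` is not itself an admissible weight at scale 1, no admissible `Φ` has this profile and
  -- the claim is vacuous. Otherwise the bounds on the weight depend on `ψ` alone.
  by_cases hψ : WeightCondition ψ 1
  swap
  · refine ⟨1, one_pos, fun N x h δ hx hh hδ Φ hΦ hΦψ i => ?_⟩
    have hpos : 0 < h := hh ▸ hx.fillDistance_pos hΩ i
    exact absurd (hΦ.profile (by rw [hδ]; positivity) hΦψ) hψ
  obtain ⟨w, W, hw, hW, hψw, hψW⟩ := hψ.exists_bounds
  obtain ⟨A, hA, hres⟩ := exists_lsqFunctional_midTaylor_le hm hΩ hS c W hW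
  -- Chosen so that `w B²` equals four times the residual bound, the form that the stability
  -- estimate takes.
  set B₀ := 2 * A / √w with hB₀
  have hB₀pos : 0 < B₀ := by positivity
  -- The first `d` pays for the Laplacian of the Taylor polynomial when `m = 1`, the second term for
  -- the derivatives of `q - p`; the 1 keeps the constant positive when `d = 0`.
  refine ⟨d + d * (2 * B₀) + 1, by positivity,
    fun N x h δ hx hh hδ Φ hΦ hΦψ i ε hε hδε φ hφ g hg => ?_⟩
  subst hh hδ hg
  have hpos : 0 < fillDistance x Ω := hx.fillDistance_pos hΩ i
  set h := fillDistance x Ω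
  set g := topGrad x hε i (restrictNodal x ε i fun j => φ (x j))
  have hδpos : 0 < 2 * coneConst m θ * h := by positivity
  have hnn : ∀ j : Nbr x ε i, 0 ≤ Φ ‖x i - edgeMid x i j‖ := fun j =>
    hΦ.nonneg _ (norm_nonneg _)
  have hΦW : ∀ s, 0 ≤ s → Φ s ≤ W := fun s hs => by
    rw [hΦψ s hs]
    exact hψW _ (by positivity)
  have hΦw : ∀ s, 0 ≤ s → s ≤ coneConst m θ * h / 2 → w ≤ Φ s := fun s hs hs' => by
    rw [hΦψ s hs]
    refine hψw _ (by positivity) ?_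
    rw [div_le_iff₀ hδpos]
    linarith
  have hfit := isFit_gmlsFit (m := m) hnn g
  have hck : 0 ≤ ckNorm (m + 1) S φ := ckNorm_nonneg
  have hiS := hS.subset (hx.mem i)
  have hiS' := closure_mono (interior_mono hS.subset) (hΩ.mem_closure_interior (hx.mem i))
  set q := midTaylor m φ S (x i) with hq
  have hqV : q ∈ vanishingPoly m (x i) := midTaylor_mem_vanishingPoly m φ S (x i)
  set p := gmlsFit m Φ x ε i g with hp
  set B := B₀ * ckNorm (m + 1) S φ * h ^ (m + 1) with hB
  have hB0 : 0 ≤ B := by positivity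
  have hsum : ∑ j : Nbr x ε i, polyEval (edgeMid x i j) (q - p) ^ 2 * Φ ‖x i - edgeMid x i j‖
      ≤ w * B ^ 2 := by
    have h1 := (hfit.sum_sq_sub_le hnn hqV).trans
      (mul_le_mul_of_nonneg_left (hres N x hx Φ hΦ hΦW i ε hε φ hφ) (by norm_num))
    have h2 : w * B ^ 2 = 4 * (A * ckNorm (m + 1) S φ * h ^ (m + 1)) ^ 2 := by
      rw [hB, hB₀]
      simp only [mul_pow, div_pow]
      rw [Real.sq_sqrt hw.le]
      field_simp
      ring
    rw [h2]
    refine le_trans (le_of_eq (Finset.sum_congr rfl fun j _ => ?_)) h1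
    rw [polyEval_sub, polyEval_sub, sub_sq_comm]
  obtain ⟨hd1, hd2, -⟩ := hx.derivative_bounds hm hΩ hΦ hw hΦw hδε
    (sub_mem_vanishingPoly hqV hfit.1).1 hB0 hsum
  refine ⟨⟨p, hfit, fun p' hp' => ?_⟩, ?_, ?_⟩
  -- Stability with `B = 0`: the difference of two fits vanishes on a ball, hence identically.
  · have h0 : p' - p = 0 := (hx.derivative_bounds hm hΩ hΦ hw hΦw hδε
      (sub_mem_vanishingPoly hp'.1 hfit.1).1 le_rfl
      (by simpa using hp'.sum_sq_sub_eq_zero hfit)).2.2 rfl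
    exact sub_eq_zero.1 h0
  · have e1 := abs_laplacianWithin_sub_midTaylor_le hm hS.compact hφ hS.uniqueDiff hiS hiS' hpos
    rw [← hq] at e1
    have e2 : |polyLaplacian (x i) (q - p)| ≤ d * (2 * B / h ^ 2) := by
      refine (Finset.abs_sum_le_sum_abs _ _).trans ?_
      refine (Finset.sum_le_sum fun k _ => hd2 k).trans (by simp [h])
    have e3 : 2 * B / h ^ 2 = 2 * B₀ * ckNorm (m + 1) S φ * h ^ (m - 1) := by
      obtain ⟨n, rfl⟩ : ∃ n, m = n + 1 := ⟨m - 1, by omega⟩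
      rw [hB, Nat.add_sub_cancel]
      field_simp
      ring
    rw [polyLaplacian_sub, e3] at e2
    rw [gmlsDiv, ← hp]
    have e4 : InnerProductSpace.laplacianWithin φ S (x i) - 1 / 4 * polyLaplacian (x i) p
        = (InnerProductSpace.laplacianWithin φ S (x i) - 1 / 4 * polyLaplacian (x i) q)
          + 1 / 4 * (polyLaplacian (x i) q - polyLaplacian (x i) p) := by ring
    rw [e4]
    refine (abs_add_le _ _).trans ?_
    rw [abs_mul, abs_of_nonneg (by norm_num : (0 : ℝ) ≤ 1 / 4)]
    have e5 : 0 ≤ h ^ (m - 1) * ckNorm (m + 1) S φ := by positivity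
    nlinarith [abs_nonneg (polyLaplacian (x i) q - polyLaplacian (x i) p)]
  · have e1 : ‖polyGrad (x i) (q - p)‖ ≤ d * (2 * B / h) :=
      norm_le_card_mul fun k => hd1 k
    have e3 : 2 * B / h = 2 * B₀ * ckNorm (m + 1) S φ * h ^ m := by
      rw [hB]
      field_simp
      ring
    rw [polyGrad_sub, e3] at e1
    rw [gradientWithin_eq_polyGrad_midTaylor hm (hφ.of_le (by exact_mod_cast Nat.le_succ m))
      hS.uniqueDiff hiS hiS', gmlsField, ← smul_sub, ← hp, ← hq, norm_smul]
    have e5 : 0 ≤ h ^ m * ckNorm (m + 1) S φ := by positivity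
    have e6 : ‖(1 / 2 : ℝ)‖ = 1 / 2 := by norm_num
    rw [e6]
    have e7 : 0 ≤ d * (h ^ m * ckNorm (m + 1) S φ) := by positivity
    nlinarith [norm_nonneg (polyGrad (x i) q - polyGrad (x i) p)]
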